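/- \textbf{Setting.} Strings are over an integer alphabet $\{0,\dots,\sigma-1\}$, $T$ is a non-empty string of length $n$, and $\sigma = n^{O(1)}$. $T[i+1..n]\,T[1..i]$ is the $i$-th conjugate of $T$ ($0\le i<n$). $T$ is primitive if it is not $S^k$ for some $S$ and $k\ge 2$. A Lyndon word is a non-empty string lexicographically smaller than each of its proper non-empty suffixes, and the Lyndon factorization of $T$ is the unique factorization $T=T_1\cdots T_t$ into lexicographically non-increasing Lyndon words. Write $S\prec_\omega U$ if $SSS\cdots$ is lexicographically smaller than $UUU\cdots$. $\mathrm{BBWT}_T$ is the string of the last characters of all conjugates of $T_1,\dots,T_t$ (with multiplicity), sorted by $\prec_\omega$. $\mathrm{BWTC}_T$ is the string of the last characters of the $n$ conjugates of $T$ (with multiplicity), sorted lexicographically. For a string $B$ and a position $p$ of $B$, let $\mathrm{LF}[p]$ be the number of characters of $B$ smaller than $B[p]$ plus the number of occurrences of $B[p]$ in $B[1..p]$. The \emph{insertion algorithm} (Bonomo et al.) starts with empty $B$. For $x=1,\dots,t$ it prepends the last character of $T_x$ to $B$ and sets $p\gets 1$; then for $j=|T_x|-1$ down to $1$ it sets $p\gets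 \mathrm{LF}[p]+1$ (with $\mathrm{LF}$ taken on the current $B$) and inserts $T_x[j]$ into $B$ so that it becomes the $p$-th character. The machine is a word RAM with the rewritable array $T[1..n]$, whose cells hold only characters of the alphabet. An algorithm is \emph{in-place} if besides this array it uses $O(\log n)$ bits of working space, here a constant number of registers of $O(\log n)$ bits each. \textbf{Theorem.} \begin{enumerate} \item After its $n$ insertions the insertion algorithm has computed $B=\mathrm{BBWT}_T$. \item There is an in-place program that, on every input $T$, carries out the insertion algorithm in the array (after each insertion the array holds $B$ followed by the characters not yet inserted, in text order), spends $O(n)$ time per insertion including its backward step $\mathrm{LF}$, and halts after $O(n^2)$ time with $\mathrm{BBWT}_T$ in the array. \item If $T$ is a Lyndon word, then $\mathrm{BWTC}_T=\mathrm{BBWT}_T$. A non-empty primitive string $P$ has, for exactly one $j\in[0..|P|-1]$, a $j$-th conjugate that is a Lyndon word (its Lyndon conjugate $L$), and $\mathrm{BWTC}_P=\mathrm{BBWT}_L$. Every non-empty $T$ is $P^k$ with $P$ non-empty and primitive and $k\ge1$, and $\mathrm{BWTC}_{P^k}$ arises from $\mathrm{BWTC}_P$ by replacing each character by a run of $k$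 copies of it. \item There is an in-place program that, on every input $T=P^k$ ($P$ primitive), carries out the insertion algorithm for the Lyndon conjugate $L$ of $P$ on the first $|P|$ cells of the array, with $O(n)$ time per insertion, and halts after $O(n^2)$ time with $\mathrm{BWTC}_T$ in the array. \end{enumerate} -/

import Mathlib

namespace BWTInPlace

/-! ### Strings over the integer alphabet

A string is a list of natural numbers.  Lists carry Mathlib's lexicographic linear order, and the
`i`-th conjugate of `T` is `T.rotate i`.  Positions in strings are counted from `1` in the
functions `charAt`, `rank` and `LF`. -/

/-- The `k`-fold concatenation `S ^ k`. -/
def strPow (S : List ℕ) (k : ℕ) : List ℕ := (List.replicate k S).flatten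

/-- `T` is not of the form `S ^ k` with `S` non-empty and `k ≥ 2`. -/
def IsPrimitive (T : List ℕ) : Prop := ∀ S : List ℕ, S ≠ [] → ∀ k, 2 ≤ k → T ≠ strPow S k

/-- A Lyndon word: a non-empty string that is lexicographically smaller than each of its
proper (non-empty) suffixes. -/
def IsLyndon (T : List ℕ) : Prop := T ≠ [] ∧ ∀ i, 0 < i → i < T.length → T < T.drop i

/-- `F = [T₁, …, T_t]` is a Lyndon factorization of `T`: the factors are Lyndon words, they are
lexicographically non-increasing, and their concatenation is `T`. -/
def IsLyndonFactorization (T : List ℕ) (F : List (List ℕ)) : Prop :=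
  F.flatten = T ∧ (∀ f ∈ F, IsLyndon f) ∧ F.Pairwise (fun f g => g ≤ f)

/-- The Lyndon factorization of `T` (existence and uniqueness are part of the theorem). -/
noncomputable def lyndonFactors (T : List ℕ) : List (List ℕ) :=
  Classical.epsilon (IsLyndonFactorization T)

/-- The infinite concatenation `S S S ⋯` of a non-empty string, as a sequence. -/
def omegaPow (S : List ℕ) (i : ℕ) : ℕ := S.getD (i % S.length) 0

/-- The strict order `S ≺_ω T`: `S S S ⋯` is lexicographically smaller than `T T T ⋯`. -/
def OmegaLT (S T : List ℕ) : Prop :=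
  ∃ l, (∀ i < l, omegaPow S i = omegaPow T i) ∧ omegaPow S l < omegaPow T l

/-- All conjugates of `T`, with multiplicity. -/
def conjugates (T : List ℕ) : List (List ℕ) := (List.range T.length).map T.rotate

/-- The string of the last characters of a list of (non-empty) strings. -/
def lastChars (L : List (List ℕ)) : List ℕ := L.map (fun S => S.getLastD 0)

open Classical in
/-- The bijective BWT: the last characters of the conjugates of all Lyndon factors, sorted with
respect to the `≺_ω` order. -/
noncomputable def bbwt (T : List ℕ) : List ℕ :=
  lastChars (((lyndonFactors T).flatMap conjugates).insertionSort (fun S U => ¬ OmegaLT U S))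

/-- The cyclic BWT: the last characters of the lexicographically sorted conjugates. -/
def bwtc (T : List ℕ) : List ℕ := lastChars ((conjugates T).insertionSort (· ≤ ·))

/-- Replace each character by a run of `k` copies of it. -/
def expandRuns (k : ℕ) (B : List ℕ) : List ℕ := B.flatMap (fun c => List.replicate k c)

/-! ### Backward steps and the insertion algorithm -/

/-- The character `B[p]`, for `1 ≤ p ≤ |B|`. -/
def charAt (B : List ℕ) (p : ℕ) : ℕ := B.getD (p - 1) 0

/-- The number of occurrences of `c` in `B[1..j]`. -/
def rank (B : List ℕ) (c j : ℕ) : ℕ := (B.take j).count c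

/-- `C[c]`: the number of positions of `B` whose character is smaller than `c`. -/
def countSmaller (B : List ℕ) (c : ℕ) : ℕ := B.countP (fun d => decide (d < c))

/-- The backward step `LF[p] = C[B[p]] + rank_{B[p]}(p)` on `B`. -/
def LF (B : List ℕ) (p : ℕ) : ℕ := countSmaller B (charAt B p) + rank B (charAt B p) p

/-- A state of the insertion algorithm: the transform `built` so far, the position `pos` of the
character inserted last, the part `cur` of the current Lyndon factor that is not yet inserted,
and the Lyndon factors `rest` after it. -/
structure InsState where
  built : List ℕ
  pos : ℕ
  cur : List ℕ
  rest : List (List ℕ)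

/-- One insertion.  If the current factor is used up, prepend the last character of the next
factor and set `p ← 1`; otherwise set `p ← LF[p] + 1` and insert the last uninserted character of
the current factor such that it becomes the `p`-th character.  A finished state is not changed. -/
def InsState.next (s : InsState) : InsState :=
  match s.cur with
  | [] =>
    match s.rest with
    | [] => s
    | f :: F => ⟨f.getLastD 0 :: s.built, 1, f.dropLast, F⟩
  | c :: u =>
    let p := LF s.built s.pos + 1
    ⟨s.built.insertIdx (p - 1) ((c :: u).getLastD 0), p, (c :: u).dropLast, s.rest⟩

/-- The state of the algorithm on input `T` after `i` insertions. -/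
noncomputable def insState (T : List ℕ) (i : ℕ) : InsState :=
  InsState.next^[i] ⟨[], 0, [], lyndonFactors T⟩

/-- The string that the algorithm keeps in the text array after `i` insertions: the transform
built so far, followed by all characters that have not been inserted, in text order. -/
noncomputable def insLayout (T : List ℕ) (i : ℕ) : List ℕ :=
  (insState T i).built ++ (insState T i).cur ++ (insState T i).rest.flatten

/-! ### The word RAM

A machine has the rewritable input, an array with one character of the alphabet `{0, …, σ - 1}`
per cell, and as its only further memory a number of registers that is fixed with the program;
each register holds a `w`-bit number.  The instruction set is a small part of that of the word
RAM, with the control flow in structured form. -/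

/-- Comparisons of two registers. -/
inductive Cond (r : ℕ) where
  | lt (x y : Fin (r + 1))
  | le (x y : Fin (r + 1))
  | eq (x y : Fin (r + 1))
  | ne (x y : Fin (r + 1))

/-- Programs for a machine with the `r + 1` registers `0, …, r`. -/
inductive Prog (r : ℕ) where
  | skip
  | const (x : Fin (r + 1)) (v : ℕ)
  | copy (x y : Fin (r + 1))
  | add (x y z : Fin (r + 1))
  | sub (x y z : Fin (r + 1))
  | load (x y : Fin (r + 1))
  | store (x y : Fin (r + 1))
  | seq (p q : Prog r)
  | ite (b : Cond r) (p q : Prog r)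
  | loop (b : Cond r) (p : Prog r)

/-- A configuration: the control stack of program parts that are still to be executed (for a
fixed program only finitely many stacks can arise), the registers, and the text array. -/
structure Config (r : ℕ) where
  todo : List (Prog r)
  reg : Fin (r + 1) → ℕ
  text : List ℕ

/-- The truth value of a comparison. -/
def Cond.holds {r : ℕ} (b : Cond r) (g : Fin (r + 1) → ℕ) : Bool :=
  match b with
  | .lt x y => decide (g x < g y)
  | .le x y => decide (g x ≤ g y)
  | .eq x y => decide (g x = g y)
  | .ne x y => decide (g x ≠ g y)

/-- Write `v` to register `x` and continue with `K`; a fault if `v` is not a `w`-bit number. -/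
def writeReg {r : ℕ} (w : ℕ) (K : List (Prog r)) (g : Fin (r + 1) → ℕ) (A : List ℕ)
    (x : Fin (r + 1)) (v : ℕ) : Option (Config r) :=
  if v < 2 ^ w then some ⟨K, Function.update g x v, A⟩ else none

/-- One step of a machine with word size `w` and alphabet `{0, …, σ - 1}`.  The value is `none` if
the machine has halted (empty control stack), and also if it faults: a number that does not fit
into a register, an array access out of bounds, or an attempt to store a number that is not a
character.  `load x y` reads the array cell with index `y` (from `0`) into `x`, and `store x y`
writes `y` to the cell with index `x`.  Subtraction is truncated at `0`. -/
def step {r : ℕ} (w σ : ℕ) (c : Config r) : Option (Config r) :=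
  match c.todo with
  | [] => none
  | i :: K =>
    match i with
    | .skip => some ⟨K, c.reg, c.text⟩
    | .const x v => writeReg w K c.reg c.text x v
    | .copy x y => writeReg w K c.reg c.text x (c.reg y)
    | .add x y z => writeReg w K c.reg c.text x (c.reg y + c.reg z)
    | .sub x y z => writeReg w K c.reg c.text x (c.reg y - c.reg z)
    | .load x y =>
      match c.text[c.reg y]? with
      | some v => writeReg w K c.reg c.text x v
      | none => none
    | .store x y =>
      if c.reg x < c.text.length ∧ c.reg y < σ then
        some ⟨K, c.reg, c.text.set (c.reg x) (c.reg y)⟩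
      else none
    | .seq p q => some ⟨p :: q :: K, c.reg, c.text⟩
    | .ite b p q => some ⟨(if b.holds c.reg then p else q) :: K, c.reg, c.text⟩
    | .loop b p => some ⟨if b.holds c.reg then p :: .loop b p :: K else K, c.reg, c.text⟩

/-- The configuration after exactly `t` steps, if there are `t` steps without fault. -/
def run {r : ℕ} (w σ : ℕ) : ℕ → Config r → Option (Config r)
  | 0, c => some c
  | t + 1, c => (step w σ c).bind (run w σ t)

/-- The start on input `T`: register `0` holds `|T|`, the other registers hold `0`. -/
def startConfig {r : ℕ} (p : Prog r) (T : List ℕ) : Config r :=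
  ⟨[p], fun x => if x = 0 then T.length else 0, T⟩

/-- On input `T` the program halts without fault after at most `t` steps, and the text array then
holds `out`. -/
def HaltsWith {r : ℕ} (w σ : ℕ) (p : Prog r) (T : List ℕ) (t : ℕ) (out : List ℕ) : Prop :=
  ∃ s ≤ t, ∃ c, run w σ s (startConfig p T) = some c ∧ c.todo = [] ∧ c.text = out

/-- During its run on input `T` the program carries out the insertion algorithm for `L` on the
first `|L|` cells of the text array, with at most `d` steps for each insertion (this includes the
backward step): one after the other, the strings `insLayout L 0, …, insLayout L |L|` stand there,
at most `d` steps apart. -/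
def PerformsInsertions {r : ℕ} (w σ : ℕ) (p : Prog r) (T L : List ℕ) (d : ℕ) : Prop :=
  ∃ τ : ℕ → ℕ,
    (∀ i < L.length, τ i < τ (i + 1) ∧ τ (i + 1) ≤ τ i + d) ∧
    ∀ i ≤ L.length, ∃ c, run w σ (τ i) (startConfig p T) = some c ∧ insLayout L i <+: c.text

/-- The word size: at most `C` times the number of bits of `n`, hence `O(log n)` bits. -/
def wordBits (C n : ℕ) : ℕ := C * (Nat.log 2 n + 1)

/-- `T` is a non-empty string over `{0, …, σ - 1}`, with an alphabet of size `n ^ O(1)`: the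
exponent is `a` (and `n + 1` instead of `n` admits larger alphabets for `n = 1`). -/
def IsInput (a σ : ℕ) (T : List ℕ) : Prop :=
  T ≠ [] ∧ (∀ c ∈ T, c < σ) ∧ σ ≤ (T.length + 1) ^ a

end BWTInPlace

open BWTInPlace

namespace BWTInPlace

/-! All comparisons are moved to infinite powers. The sequence `key S` lives in a linear order, and
on strings of equal length this order agrees with the lexicographic one (`key_lt_key`). The cyclic
predecessor of a conjugate arises by moving its last character to the front. Hence predecessors
compare first by last characters and then by the rows themselves (`predKey_lt_iff`). This is the
principle behind LF.

Correctness of the insertions: while a Lyndon factor f is processed, the sorted rows are the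
conjugates of the earlier factors and the rotations of f inserted so far. As multisets of keys, the
rows and their predecessors differ in one element each: the predecessor of the newest row r is
missing, and f is not yet a predecessor (`InsInv.perm`). Counting the keys below the missing one
gives exactly LF of the position of r, because f is smaller than its proper rotations and supplies
the summand one (`InsInv.countP_key`). A new factor may start in front because the factors do not
increase, which passes to infinite powers (`key_le_key_of_le`). At the end the rows are a sorted
arrangement of all conjugates. Ties do no harm, since equal infinite powers have equal last
characters (`getLastD_eq_of_key_eq`).

Cyclic transform: the conjugates of one word have equal length, so for a Lyndon word both sorting
orders agree. A primitive word differs from its proper rotations, so its least rotation is strictly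
least, and this makes it Lyndon (`isLyndon_of_lt_rotate`). The conjugates of P^k are the k-th powers
of those of P, each k times.

Machine: the factorization is never stored. When a factor is used up, Duval's scan with two pointers
finds the next one in the remaining text (`DuvalInv.length_eq`). A backward step is one counting
pass, an insertion one shift. For the cyclic transform neither P nor k is known. The text is rotated
until the scan and one division show a power of a Lyndon word L (`search_test`). The first |L| cells
are then transformed, and the runs are written from right to left, so that no unread character is
lost (`exec_expand`). -/

/-- The infinite power of a string as an element of the lexicographic order. -/
def key (S : List ℕ) : Lex (ℕ → ℕ) := toLex (omegaPow S)

/-! ### Lexicographic comparison by first mismatch -/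

theorem lexSeq_lt_iff (x y : ℕ → ℕ) :
    toLex x < toLex y ↔ ∃ l, (∀ i < l, x i = y i) ∧ x l < y l := Iff.rfl

theorem lt_of_mismatch {s t : List ℕ} (l : ℕ) (hs : l < s.length) (ht : l < t.length)
    (heq : ∀ i < l, s.getD i 0 = t.getD i 0) (hlt : s.getD l 0 < t.getD l 0) : s < t := by
  rw [List.lt_iff_exists]
  refine Or.inr ⟨l, hs, ht, fun j hj => ?_, ?_⟩
  · have := heq j hj
    rwa [List.getD_eq_getElem _ _ (by omega), List.getD_eq_getElem _ _ (by omega)] at this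
  · rwa [List.getD_eq_getElem _ _ (by omega), List.getD_eq_getElem _ _ (by omega)] at hlt

/-- The length hypothesis excludes that `s` is a proper prefix of `t`, so the order is decided at a
genuine mismatch. -/
theorem mismatch_of_lt {s t : List ℕ} (h : s < t) (hlen : t.length ≤ s.length) :
    ∃ l, l < s.length ∧ l < t.length ∧ (∀ i < l, s.getD i 0 = t.getD i 0) ∧
      s.getD l 0 < t.getD l 0 := by
  rw [List.lt_iff_exists] at h
  rcases h with ⟨_, h⟩ | ⟨i, h1, h2, h3, h4⟩
  · omega
  · refine ⟨i, h1, h2, fun j hj => ?_, ?_⟩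
    · rw [List.getD_eq_getElem _ _ (by omega), List.getD_eq_getElem _ _ (by omega)]
      exact h3 j hj
    · rwa [List.getD_eq_getElem _ _ (by omega), List.getD_eq_getElem _ _ (by omega)]

theorem getD_drop (s : List ℕ) (i j : ℕ) : (s.drop i).getD j 0 = s.getD (i + j) 0 := by
  simp [List.getD_eq_getElem?_getD]

theorem getD_take (s : List ℕ) {i j : ℕ} (h : j < i) : (s.take i).getD j 0 = s.getD j 0 := by
  simp [List.getD_eq_getElem?_getD, h]

theorem getD_append_left (s t : List ℕ) {j : ℕ} (h : j < s.length) :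
    (s ++ t).getD j 0 = s.getD j 0 := List.getD_append _ _ _ _ h

theorem getD_append_right (s t : List ℕ) {j : ℕ} (h : s.length ≤ j) :
    (s ++ t).getD j 0 = t.getD (j - s.length) 0 := List.getD_append_right _ _ _ _ h

theorem ext_getD {s t : List ℕ} (hl : s.length = t.length)
    (h : ∀ i < s.length, s.getD i 0 = t.getD i 0) : s = t := by
  refine List.ext_getElem hl fun i h1 h2 => ?_
  have := h i h1
  rwa [List.getD_eq_getElem _ _ h1, List.getD_eq_getElem _ _ h2] at this

theorem getD_rotate (s : List ℕ) (j i : ℕ) (h : i < s.length) :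
    (s.rotate j).getD i 0 = s.getD ((i + j) % s.length) 0 := by
  rw [List.getD_eq_getElem _ _ (by simpa using h), List.getElem_rotate,
    List.getD_eq_getElem _ _ (Nat.mod_lt _ (by omega))]

/-- A proper suffix is shorter than `w`, so `w` can only be smaller through a mismatch inside the
suffix. In this form the condition carries over to rotations and infinite powers and is maintained
by Duval's scan. -/
theorem lyndon_iff (w : List ℕ) : IsLyndon w ↔ w ≠ [] ∧ ∀ i, 0 < i → i < w.length →
    ∃ l, i + l < w.length ∧ (∀ m < l, w.getD m 0 = w.getD (i + m) 0) ∧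
      w.getD l 0 < w.getD (i + l) 0 := by
  refine and_congr_right fun _ => forall_congr' fun i => forall_congr' fun h0 =>
    forall_congr' fun hi => ⟨fun h => ?_, ?_⟩
  · obtain ⟨l, h1, h2, h3, h4⟩ := mismatch_of_lt h (by simp)
    simp only [getD_drop, List.length_drop] at *
    exact ⟨l, by omega, h3, h4⟩
  · rintro ⟨l, h1, h2, h3⟩
    exact lt_of_mismatch l (by omega) (by simp; omega) (by simpa [getD_drop] using h2)
      (by simpa [getD_drop] using h3)

theorem IsLyndon.length_pos {w : List ℕ} (h : IsLyndon w) : 0 < w.length :=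
  List.length_pos_iff.2 h.1

theorem isLyndon_singleton (c : ℕ) : IsLyndon [c] :=
  ⟨by simp, fun i h0 h1 => by simp at h1; omega⟩

/-! ### Infinite powers -/

theorem omegaPow_of_lt {S : List ℕ} {i : ℕ} (h : i < S.length) : omegaPow S i = S.getD i 0 := by
  rw [omegaPow, Nat.mod_eq_of_lt h]

theorem omegaPow_add_length (S : List ℕ) (i : ℕ) : omegaPow S (i + S.length) = omegaPow S i := by
  simp [omegaPow]

theorem omegaPow_congr_mod (S : List ℕ) {i j : ℕ} (h : i % S.length = j % S.length) :
    omegaPow S i = omegaPow S j := by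
  simp [omegaPow, h]

theorem omegaPow_rotate (S : List ℕ) (j i : ℕ) :
    omegaPow (S.rotate j) i = omegaPow S (i + j) := by
  rcases Nat.eq_zero_or_pos S.length with h | h
  · simp [List.length_eq_zero_iff.1 h, omegaPow]
  · rw [omegaPow, omegaPow, List.length_rotate, getD_rotate _ _ _ (Nat.mod_lt _ h)]
    simp

/-- A Lyndon word is strictly smaller than all its proper rotations, as infinite powers. -/
theorem IsLyndon.key_lt_key_rotate {w : List ℕ} (h : IsLyndon w) {i : ℕ} (h0 : 0 < i)
    (hi : i < w.length) : key w < key (w.rotate i) := by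
  obtain ⟨l, h1, h2, h3⟩ := ((lyndon_iff w).1 h).2 i h0 hi
  refine ⟨l, fun m hm => ?_, ?_⟩
  · change omegaPow w m = omegaPow (w.rotate i) m
    rw [omegaPow_rotate, omegaPow_of_lt (by omega), omegaPow_of_lt (by omega), h2 m hm, add_comm]
  · change omegaPow w l < omegaPow (w.rotate i) l
    rwa [omegaPow_rotate, omegaPow_of_lt (by omega), omegaPow_of_lt (by omega), add_comm]

theorem IsLyndon.key_le_key_rotate {w : List ℕ} (h : IsLyndon w) (i : ℕ) :
    key w ≤ key (w.rotate i) := by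
  rw [← List.rotate_mod]
  rcases Nat.eq_zero_or_pos (i % w.length) with h0 | h0
  · simp [h0]
  · exact (h.key_lt_key_rotate h0 (Nat.mod_lt _ h.length_pos)).le

theorem IsLyndon.toLex_le_shift {w : List ℕ} (h : IsLyndon w) (i : ℕ) :
    toLex (omegaPow w) ≤ toLex (fun n => omegaPow w (n + i)) := by
  have := h.key_le_key_rotate i
  rwa [key, key, funext (omegaPow_rotate w i)] at this

/-- The first mismatch of two distinct strings of equal length lies within their first periods. -/
theorem key_lt_key {S U : List ℕ} (hlen : S.length = U.length) : key S < key U ↔ S < U := by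
  have main : ∀ {S U : List ℕ}, S.length = U.length → S < U → key S < key U := by
    intro S U hlen h
    obtain ⟨l, h1, h2, h3, h4⟩ := mismatch_of_lt h hlen.ge
    refine ⟨l, fun m hm => ?_, ?_⟩
    · change omegaPow S m = omegaPow U m
      rw [omegaPow_of_lt (by omega), omegaPow_of_lt (by omega), h3 m hm]
    · change omegaPow S l < omegaPow U l
      rwa [omegaPow_of_lt (by omega), omegaPow_of_lt (by omega)]
  refine ⟨fun h => ?_, main hlen⟩
  by_contra hc
  rcases (not_lt.1 hc).lt_or_eq with h1 | h1
  · exact (h.trans (main hlen.symm h1)).false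
  · subst h1; exact h.false

theorem key_le_key {S U : List ℕ} (hlen : S.length = U.length) : key S ≤ key U ↔ S ≤ U := by
  rw [← not_lt, ← not_lt]
  exact not_congr (key_lt_key hlen.symm)

theorem IsLyndon.lt_rotate {w : List ℕ} (h : IsLyndon w) {i : ℕ} (h0 : 0 < i)
    (hi : i < w.length) : w < w.rotate i :=
  (key_lt_key (by simp)).1 (h.key_lt_key_rotate h0 hi)

theorem IsLyndon.le_rotate {w : List ℕ} (h : IsLyndon w) (i : ℕ) : w ≤ w.rotate i :=
  (key_le_key (by simp)).1 (h.key_le_key_rotate i)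

/-- Among Lyndon words the order of infinite powers follows the lexicographic order. -/
theorem key_le_key_of_le {f g : List ℕ} (hf : f ≠ []) (hg : IsLyndon g) (h : f ≤ g) :
    key f ≤ key g := by
  by_contra hc
  obtain ⟨l, h1, h2⟩ := not_le.1 hc
  change ∀ m < l, omegaPow g m = omegaPow f m at h1
  change omegaPow g l < omegaPow f l at h2
  have hf0 := List.length_pos_iff.2 hf
  have hg0 := hg.length_pos
  rcases lt_or_ge l f.length with hl | hl
  · rcases lt_or_ge l g.length with hl' | hl'
    · refine (lt_of_mismatch l hl' hl (fun m hm => ?_) ?_).not_ge h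
      · have := h1 m hm
        rwa [omegaPow_of_lt (by omega), omegaPow_of_lt (by omega)] at this
      · rwa [omegaPow_of_lt (by omega), omegaPow_of_lt (by omega)] at h2
    · refine absurd h (not_le.2 ?_)
      rw [List.lt_iff_exists]
      refine Or.inl ⟨ext_getD (by simp; omega) fun m hm => ?_, by omega⟩
      have := h1 m (by omega)
      rw [omegaPow_of_lt (by omega), omegaPow_of_lt (by omega)] at this
      rw [getD_take _ hm, this]
  -- Both powers agree on the first copy of `f`. Dropping these characters from the power of `g`
  -- gives a shift whose first difference from the unshifted power is at `l - f.length`, where it is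
  -- smaller. The infinite power of a Lyndon word has no smaller shift.
  · refine (hg.toLex_le_shift f.length).not_gt ?_
    have hsub : ∀ m, omegaPow f m = omegaPow f (m + f.length) := fun m =>
      (omegaPow_add_length f m).symm
    refine ⟨l - f.length, fun m hm => ?_, ?_⟩
    · change omegaPow g (m + f.length) = omegaPow g m
      rw [h1 _ (by omega), h1 _ (by omega), omegaPow_add_length]
    · change omegaPow g (l - f.length + f.length) < omegaPow g (l - f.length)
      rw [h1 (l - f.length) (by omega), hsub, Nat.sub_add_cancel hl]
      exact h2

/-! ### The Lyndon factorization -/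

theorem le_append (s t : List ℕ) : s ≤ s ++ t := by
  induction s with
  | nil => exact not_lt.1 (List.not_lt_nil _)
  | cons a s ih =>
    refine not_lt.1 fun h => ?_
    rcases List.cons_lt_cons_iff.1 h with h | ⟨-, h⟩
    · exact h.false
    · exact h.not_ge ih

theorem append_lt_append_of_length_le {s t : List ℕ} (h : s < t) (hlen : t.length ≤ s.length)
    (u v : List ℕ) : s ++ u < t ++ v := by
  obtain ⟨l, h1, h2, h3, h4⟩ := mismatch_of_lt h hlen
  refine lt_of_mismatch l (by simp; omega) (by simp; omega) (fun i hi => ?_) ?_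
  · rw [getD_append_left _ _ (by omega), getD_append_left _ _ (by omega), h3 i hi]
  · rwa [getD_append_left _ _ (by omega), getD_append_left _ _ (by omega)]

theorem append_lt_append_left {s t : List ℕ} (u : List ℕ) (h : s < t) : u ++ s < u ++ t := by
  induction u with
  | nil => exact h
  | cons a s ih => exact List.cons_lt_cons_iff.2 (Or.inr ⟨rfl, ih⟩)

/-- Everything rests on `u ++ v < v`: if `u` is a prefix of `v`, this reduces to `v` being smaller
than its own suffix, and otherwise the mismatch of `u` and `v` decides. Suffixes that start inside
`u` are handled by `u` being Lyndon, later ones by `v` being Lyndon. -/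
theorem IsLyndon.append {u v : List ℕ} (hu : IsLyndon u) (hv : IsLyndon v) (h : u < v) :
    IsLyndon (u ++ v) := by
  have huv : u ++ v < v := by
    have h' := h
    rw [List.lt_iff_exists] at h
    rcases h with ⟨h1, h2⟩ | ⟨i, h1, h2, h3, h4⟩
    · obtain ⟨v', rfl⟩ : ∃ v', v = u ++ v' := ⟨v.drop u.length, by
        conv_lhs => rw [← List.take_append_drop u.length v, ← h1]⟩
      have := hv.2 u.length hu.length_pos h2
      rw [List.drop_left] at this
      exact append_lt_append_left u this
    · refine lt_of_mismatch i (by simp; omega) h2 (fun j hj => ?_) ?_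
      · rw [getD_append_left _ _ (by omega), List.getD_eq_getElem _ _ (by omega),
          List.getD_eq_getElem _ _ (by omega), h3 j hj]
      · rwa [getD_append_left _ _ (by omega), List.getD_eq_getElem _ _ (by omega),
          List.getD_eq_getElem _ _ (by omega)]
  refine ⟨by simp [hu.1], fun i h0 hi => ?_⟩
  rcases lt_trichotomy i u.length with hc | hc | hc
  · rw [List.drop_append_of_le_length hc.le]
    exact append_lt_append_of_length_le (hu.2 i h0 hc) (by simp) _ _
  · rw [hc, List.drop_left]; exact huv
  · rw [List.drop_append, List.drop_eq_nil_of_le hc.le, List.nil_append]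
    simp only [List.length_append] at hi
    exact huv.trans (hv.2 _ (by omega) (by omega))

/-- The first factor of a Lyndon factorization is the longest Lyndon prefix. -/
theorem not_isLyndon_take {f : List ℕ} {F : List (List ℕ)}
    (hF : (f :: F).Pairwise (fun f g => g ≤ f)) {l : ℕ} (hl : f.length < l)
    (hl' : l ≤ (f :: F).flatten.length) : ¬ IsLyndon ((f :: F).flatten.take l) := by
  intro hx
  rw [List.pairwise_cons] at hF
  simp only [List.flatten_cons, List.length_append] at hx hl'
  obtain ⟨hfF, -⟩ := hF
  have aux : ∀ (F : List (List ℕ)) (X : List ℕ), (∀ g ∈ F, g ≤ f) → X.length < l →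
      l ≤ X.length + F.flatten.length → X ≠ [] → f.length ≤ X.length →
      IsLyndon ((X ++ F.flatten).take l) → f <+: X → False := by
    intro F
    induction F with
    | nil => intro X _ h1 h2; simp at h2; omega
    | cons g F ih =>
      intro X hg h1 h2 h3 h4 h5 h6
      simp only [List.flatten_cons, List.length_append] at h2 h5
      rcases le_or_gt l (X.length + g.length) with h | h
      -- The prefix ends inside `g`. Its part in `g` is a suffix that is at most `g`, hence at most
      -- `f`, hence at most the whole prefix, which begins with `f`. A Lyndon word has no such
      -- proper suffix.
      · obtain ⟨X', rfl⟩ := h6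
        have hlt := h5.2 _ (List.length_pos_iff.2 h3) (by simp at *; omega)
        rw [List.drop_take, List.drop_left, List.take_append_of_le_length (l₁ := g)
          (by simp only [List.length_append] at *; omega)] at hlt
        have e1 : g.take (l - (f ++ X').length) ≤ g := by
          conv_rhs => rw [← List.take_append_drop (l - (f ++ X').length) g]
          exact le_append _ _
        have e2 : f ≤ (f ++ X' ++ (g ++ F.flatten)).take l := by
          rw [List.append_assoc, List.take_append, List.take_of_length_le (by simp at *; omega)]
          exact le_append _ _
        exact (hlt.trans_le ((e1.trans (hg g (by simp))).trans e2)).false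
      · refine ih (X ++ g) (fun g' hg' => hg g' (by simp [hg'])) (by simp; omega)
          (by simp only [List.length_append]; omega) (by simp [h3]) (by simp; omega) ?_ (h6.trans (List.prefix_append _ _))
        rwa [List.append_assoc]
  by_cases hf : f = []
  · subst hf
    have hF0 : ∀ g ∈ F, g = [] := fun g hg => by
      have := hfF g hg
      exact le_antisymm this (not_lt.1 (List.not_lt_nil _))
    have : F.flatten = [] := by simpa using hF0
    simp [this] at hl'
    simp at hl
    omega
  · exact aux F f hfF hl hl' hf le_rfl hx List.prefix_rfl

/-- The first factor is determined as the longest Lyndon prefix; the rest follows by induction. -/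
theorem lyndonFactorization_unique : ∀ {F G : List (List ℕ)} {T : List ℕ},
    IsLyndonFactorization T F → IsLyndonFactorization T G → F = G := by
  intro F
  induction F with
  | nil =>
    rintro G T ⟨rfl, -, -⟩ ⟨h1, h2, -⟩
    cases G with
    | nil => rfl
    | cons g G =>
      have := (h2 g (by simp)).1
      simp at h1
      exact absurd h1.1 this
  | cons f F ih =>
    rintro G T ⟨rfl, h2, h3⟩ ⟨k1, k2, k3⟩
    cases G with
    | nil =>
      have := (h2 f (by simp)).1
      simp at k1
      exact absurd k1.1 this
    | cons g G =>
      have hf := h2 f (by simp)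
      have hg := k2 g (by simp)
      have e : f.length = g.length := by
        by_contra hne
        rcases lt_or_gt_of_ne hne with h | h
        · refine not_isLyndon_take h3 h ?_ ?_
          · rw [← k1]; simp
          · rw [← k1]; simpa using hg
        · refine not_isLyndon_take k3 h ?_ ?_
          · rw [k1]; simp
          · rw [k1]; simpa using hf
      simp only [List.flatten_cons] at k1
      obtain ⟨rfl, hGF⟩ := List.append_inj k1 e.symm
      rw [ih ⟨rfl, fun x hx => h2 x (by simp [hx]), (List.pairwise_cons.1 h3).2⟩
        ⟨hGF, fun x hx => k2 x (by simp [hx]), (List.pairwise_cons.1 k3).2⟩]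

/-- Split off the longest Lyndon prefix. If the next factor were larger, `IsLyndon.append` would
give a longer Lyndon prefix. -/
theorem exists_lyndonFactorization (T : List ℕ) : ∃ F, IsLyndonFactorization T F := by
  induction hn : T.length using Nat.strong_induction_on generalizing T with
  | _ n ih =>
  by_cases hT : T = []
  · exact ⟨[], by simp [hT], by simp, by simp⟩
  have hT0 := List.length_pos_iff.2 hT
  classical
  let l := Nat.findGreatest (fun l => IsLyndon (T.take l)) T.length
  have h1 : IsLyndon (T.take 1) := by
    obtain ⟨c, T', rfl⟩ := List.exists_cons_of_ne_nil hT
    simpa using isLyndon_singleton c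
  have hl : IsLyndon (T.take l) := Nat.findGreatest_spec (P := fun l => IsLyndon (T.take l)) hT0 h1
  have hl1 : 1 ≤ l := Nat.le_findGreatest hT0 h1
  have hlT : l ≤ T.length := Nat.findGreatest_le _
  obtain ⟨F, hF1, hF2, hF3⟩ := ih (T.drop l).length (by simp; omega) (T.drop l) rfl
  refine ⟨T.take l :: F, by simp [hF1], ?_, ?_⟩
  · intro f hf
    rcases List.mem_cons.1 hf with rfl | hf
    · exact hl
    · exact hF2 f hf
  · rw [List.pairwise_cons]
    refine ⟨?_, hF3⟩
    cases F with
    | nil => simp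
    | cons g F =>
      have hg : g ≤ T.take l := by
        by_contra hc
        have hL := hl.append (hF2 g (by simp)) (not_le.1 hc)
        have hgl := (hF2 g (by simp)).length_pos
        have hlen := congrArg List.length hF1
        simp at hlen
        have e : T.take l ++ g = T.take (l + g.length) := by
          rw [List.take_add, ← hF1]; simp
        rw [e] at hL
        have : l + g.length ≤ l :=
          Nat.le_findGreatest (P := fun l => IsLyndon (T.take l)) (by omega) hL
        omega
      intro g' hg'
      rcases List.mem_cons.1 hg' with rfl | hg'
      · exact hg
      · exact ((List.pairwise_cons.1 hF3).1 g' hg').trans hg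

theorem lyndonFactors_spec (T : List ℕ) : IsLyndonFactorization T (lyndonFactors T) :=
  Classical.epsilon_spec (exists_lyndonFactorization T)

theorem lyndonFactors_eq {T : List ℕ} {F : List (List ℕ)} (h : IsLyndonFactorization T F) :
    lyndonFactors T = F := lyndonFactorization_unique (lyndonFactors_spec T) h

theorem IsLyndon.lyndonFactors {T : List ℕ} (h : IsLyndon T) : lyndonFactors T = [T] :=
  lyndonFactors_eq ⟨by simp, by simpa using h, by simp⟩

theorem omegaPow_add_of_length_eq {S : List ℕ} {n : ℕ} (h : S.length = n) (i : ℕ) :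
    omegaPow S (i + n) = omegaPow S i := by
  rw [← h, omegaPow_add_length]

/-! ### Duval's scan for the first Lyndon factor -/

/-- The first `j` characters of `s` have the period `j - k`, and their first period is a Lyndon
word. -/
structure DuvalInv (s : List ℕ) (j k : ℕ) : Prop where
  lt : k < j
  le : j ≤ s.length
  lyndon : IsLyndon (s.take (j - k))
  period : ∀ i, i + (j - k) < j → s.getD (i + (j - k)) 0 = s.getD i 0

theorem duvalInv_start {s : List ℕ} (hs : s ≠ []) : DuvalInv s 1 0 := by
  obtain ⟨c, s, rfl⟩ := List.exists_cons_of_ne_nil hs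
  exact ⟨one_pos, by simp, by simpa using isLyndon_singleton c, fun i hi => by omega⟩

theorem DuvalInv.eq_step {s : List ℕ} {j k : ℕ} (h : DuvalInv s j k) (hj : j < s.length)
    (he : s.getD k 0 = s.getD j 0) : DuvalInv s (j + 1) (k + 1) := by
  have hlt := h.lt
  have e : j + 1 - (k + 1) = j - k := by omega
  refine ⟨by omega, hj, e ▸ h.lyndon, fun i hi => ?_⟩
  rw [e] at *
  rcases lt_or_ge (i + (j - k)) j with h1 | h1
  · exact h.period i h1
  · obtain rfl : i = k := by omega
    rw [he]
    congr 1
    omega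

theorem DuvalInv.getD_eq {s : List ℕ} {j k : ℕ} (h : DuvalInv s j k) {i : ℕ} (hi : i < j) :
    s.getD i 0 = omegaPow (s.take (j - k)) i := by
  have hlt := h.lt
  have hle := h.le
  have hlen : (s.take (j - k)).length = j - k := by simp; omega
  induction i using Nat.strong_induction_on with
  | _ i ih =>
    rcases lt_or_ge i (j - k) with h1 | h1
    · rw [omegaPow_of_lt (by omega), getD_take _ h1]
    · obtain ⟨m, rfl⟩ := Nat.exists_eq_add_of_le' h1
      rw [h.period m hi, ih m (by omega) (by omega)]
      exact (omegaPow_add_of_length_eq hlen m).symm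

/-- A finite cut of a comparison of infinite sequences: only the positions up to `n` of the shifted
power are present in the scanned text. -/
theorem toLex_le_cases {x y : ℕ → ℕ} (h : toLex x ≤ toLex y) (n : ℕ) :
    (∃ l < n, (∀ m < l, x m = y m) ∧ x l < y l) ∨ ((∀ m < n, x m = y m) ∧ x n ≤ y n) := by
  rcases h.lt_or_eq with h | h
  · obtain ⟨l, h1, h2⟩ := (lexSeq_lt_iff x y).1 h
    rcases lt_trichotomy l n with hl | rfl | hl
    · exact Or.inl ⟨l, hl, h1, h2⟩
    · exact Or.inr ⟨h1, h2.le⟩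
    · exact Or.inr ⟨fun m hm => h1 m (by omega), (h1 n hl).le⟩
  · have := toLex_inj.1 h
    subst this
    exact Or.inr ⟨fun _ _ => rfl, le_rfl⟩

/-- A character above the periodic continuation makes the whole scanned prefix Lyndon. The power of
the period word is at most its shift by `i`; either this is decided within the scanned part, or
there is agreement and the new character, exceeding the expected one, decides. -/
theorem DuvalInv.lt_step {s : List ℕ} {j k : ℕ} (h : DuvalInv s j k) (hj : j < s.length)
    (hkj : s.getD k 0 < s.getD j 0) : DuvalInv s (j + 1) 0 := by
  refine ⟨by omega, hj, ?_, fun i hi => by omega⟩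
  have hlt := h.lt
  have hlen : (s.take (j - k)).length = j - k := by simp; omega
  have hper : omegaPow (s.take (j - k)) j = s.getD k 0 := by
    rw [h.getD_eq hlt, ← omegaPow_add_length _ k, hlen]
    congr 1
    omega
  rw [lyndon_iff]
  refine ⟨by rw [← List.length_pos_iff]; simp; omega, fun i h0 hi => ?_⟩
  have hl1 : (s.take (j + 1 - 0)).length = j + 1 := by simp; omega
  rw [hl1] at hi ⊢
  have hg : ∀ m, m ≤ j → (s.take (j + 1 - 0)).getD m 0 = s.getD m 0 := fun m hm =>
    getD_take _ (by omega)
  rcases toLex_le_cases (h.lyndon.toLex_le_shift i) (j - i) with ⟨l, hl, h1, h2⟩ | ⟨h1, h2⟩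
  · refine ⟨l, by omega, fun m hm => ?_, ?_⟩
    · rw [hg _ (by omega), hg _ (by omega), h.getD_eq (by omega), h.getD_eq (by omega), h1 m hm,
        add_comm]
    · rwa [hg _ (by omega), hg _ (by omega), h.getD_eq (by omega), h.getD_eq (by omega), add_comm]
  · refine ⟨j - i, by omega, fun m hm => ?_, ?_⟩
    · rw [hg _ (by omega), hg _ (by omega), h.getD_eq (by omega), h.getD_eq (by omega), h1 m hm,
        add_comm]
    · rw [hg _ (by omega), hg _ (by omega), h.getD_eq (by omega)]
      have e : j - i + i = j := by omega
      rw [e, hper] at h2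
      rw [add_comm i, e]
      omega

/-- By periodicity the prefix agrees with its suffix at `j - k` until position `j`, where the suffix
ends or continues with a smaller character. So this suffix is not larger. -/
theorem DuvalInv.not_isLyndon_take {s : List ℕ} {j k : ℕ} (h : DuvalInv s j k)
    (hend : j = s.length ∨ s.getD j 0 < s.getD k 0) {l : ℕ} (hl : j - k < l)
    (hls : l ≤ s.length) : ¬ IsLyndon (s.take l) := by
  intro hL
  have hlt := h.lt
  have hlen : (s.take l).length = l := by simp; omega
  obtain ⟨m, h1, h2, h3⟩ := ((lyndon_iff _).1 hL).2 (j - k) (by omega) (by omega)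
  rw [hlen] at h1
  rw [getD_take _ (by omega), getD_take _ (by omega)] at h3
  rcases lt_trichotomy (j - k + m) j with hm | hm | hm
  · have := h.period m (by omega)
    rw [add_comm] at this
    omega
  · obtain rfl : m = k := by omega
    rw [hm] at h3
    omega
  · have := h2 k (by omega)
    rw [getD_take _ (by omega), getD_take _ (by omega), Nat.sub_add_cancel hlt.le] at this
    omega

/-- At the end of Duval's scan the period is the length of the first Lyndon factor. -/
theorem DuvalInv.length_eq {f : List ℕ} {F : List (List ℕ)} {j k : ℕ}
    (h : DuvalInv (f :: F).flatten j k)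
    (hend : j = (f :: F).flatten.length ∨ (f :: F).flatten.getD j 0 < (f :: F).flatten.getD k 0)
    (hf : IsLyndon f) (hF : (f :: F).Pairwise (fun f g => g ≤ f)) : j - k = f.length := by
  have hle := h.le
  rcases lt_trichotomy (j - k) f.length with h1 | h1 | h1
  · refine absurd ?_ (h.not_isLyndon_take hend h1 (by simp))
    simpa using hf
  · exact h1
  · exact absurd h.lyndon (BWTInPlace.not_isLyndon_take hF h1 (by omega))

/-! ### Powers and rotations -/

theorem strPow_succ (S : List ℕ) (k : ℕ) : strPow S (k + 1) = S ++ strPow S k := by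
  simp [strPow, List.replicate_succ]

theorem strPow_one (S : List ℕ) : strPow S 1 = S := by simp [strPow]

theorem length_strPow (S : List ℕ) (k : ℕ) : (strPow S k).length = k * S.length := by
  simp [strPow]

theorem getD_strPow (S : List ℕ) (k : ℕ) {i : ℕ} (hi : i < k * S.length) :
    (strPow S k).getD i 0 = omegaPow S i := by
  induction k generalizing i with
  | zero => simp at hi
  | succ k ih =>
    rw [strPow_succ]
    rcases lt_or_ge i S.length with h | h
    · rw [getD_append_left _ _ h, omegaPow_of_lt h]
    · rw [getD_append_right _ _ h, ih (by rw [add_mul] at hi; omega),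
        ← omegaPow_add_length, Nat.sub_add_cancel h]

theorem omegaPow_strPow (S : List ℕ) {k : ℕ} (hk : 1 ≤ k) : omegaPow (strPow S k) = omegaPow S := by
  funext i
  rcases Nat.eq_zero_or_pos S.length with h | h
  · simp [omegaPow, List.length_eq_zero_iff.1 h, strPow]
  · rw [omegaPow, length_strPow, getD_strPow _ _ (Nat.mod_lt _ (by positivity))]
    exact omegaPow_congr_mod _ (Nat.mod_mul_left_mod _ _ _)

theorem eq_of_omegaPow_eq {S U : List ℕ} (hl : S.length = U.length)
    (h : omegaPow S = omegaPow U) : S = U := by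
  refine ext_getD hl fun i hi => ?_
  rw [← omegaPow_of_lt hi, ← omegaPow_of_lt (hl ▸ hi), h]

theorem strPow_strPow (S : List ℕ) {a b : ℕ} (ha : 1 ≤ a) (hb : 1 ≤ b) :
    strPow (strPow S a) b = strPow S (a * b) := by
  refine eq_of_omegaPow_eq (by simp only [length_strPow]; ring) ?_
  rw [omegaPow_strPow _ hb, omegaPow_strPow _ ha, omegaPow_strPow _ (Nat.mul_pos ha hb)]

theorem rotate_strPow (S : List ℕ) (k j : ℕ) :
    (strPow S k).rotate j = strPow (S.rotate j) k := by
  rcases Nat.eq_zero_or_pos k with rfl | hk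
  · simp [strPow]
  · refine eq_of_omegaPow_eq (by simp [length_strPow]) ?_
    funext i
    rw [omegaPow_rotate, omegaPow_strPow _ hk, omegaPow_strPow _ hk, omegaPow_rotate]

theorem eq_strPow_of_period {P : List ℕ} {i k : ℕ} (hi : 0 < i) (hk : 1 ≤ k)
    (hlen : P.length = k * i)
    (hper : ∀ m, m + i < P.length → P.getD (m + i) 0 = P.getD m 0) :
    P = strPow (P.take i) k := by
  have hl : (P.take i).length = i := by
    rw [List.length_take, hlen]
    exact min_eq_left (Nat.le_mul_of_pos_left i hk)
  refine ext_getD (by rw [length_strPow, hl, hlen]) fun m hm => ?_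
  rw [getD_strPow _ _ (by rw [hl, ← hlen]; exact hm)]
  induction m using Nat.strong_induction_on with
  | _ m ih =>
    rcases lt_or_ge m i with h1 | h1
    · rw [omegaPow_of_lt (by omega), getD_take _ h1]
    · obtain ⟨m, rfl⟩ := Nat.exists_eq_add_of_le' h1
      rw [hper m hm, ih m (by omega) (by omega)]
      exact (omegaPow_add_of_length_eq hl m).symm

/-- The least positive rotation that fixes `P` divides `|P|`, by division with remainder. It is a
period of `P`, so `P` would be a proper power. -/
theorem IsPrimitive.rotate_ne {P : List ℕ} (hP : IsPrimitive P) {i : ℕ} (h0 : 0 < i)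
    (hi : i < P.length) : P.rotate i ≠ P := by
  intro h
  classical
  have hex : ∃ i, 0 < i ∧ P.rotate i = P := ⟨i, h0, h⟩
  obtain ⟨d, ⟨hd0, hd⟩, hmin⟩ : ∃ d, (0 < d ∧ P.rotate d = P) ∧
      ∀ e, 0 < e → P.rotate e = P → d ≤ e :=
    ⟨Nat.find hex, Nat.find_spec hex, fun e h1 h2 => Nat.find_le ⟨h1, h2⟩⟩
  have hdi : d ≤ i := hmin i h0 h
  have hmul : ∀ q, P.rotate (d * q) = P := by
    intro q
    induction q with
    | zero => simp
    | succ q ih => rw [Nat.mul_succ, ← List.rotate_rotate, ih, hd]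
  have hdvd : P.length % d = 0 := by
    by_contra hne
    have h1 : P.rotate (P.length % d) = P := by
      have h2 := List.rotate_length P
      rw [← Nat.div_add_mod P.length d, ← List.rotate_rotate, hmul] at h2
      exact h2
    have := hmin _ (Nat.pos_of_ne_zero hne) h1
    exact absurd (Nat.mod_lt P.length hd0) (by omega)
  obtain ⟨k, hk⟩ := Nat.dvd_of_mod_eq_zero hdvd
  have hk2 : 2 ≤ k := by
    by_contra hc
    interval_cases k <;> omega
  refine hP (P.take d) ?_ k hk2 (eq_strPow_of_period hd0 (by omega) (by rw [hk, mul_comm]) ?_)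
  · rw [← List.length_pos_iff]; simp; omega
  · intro m hm
    conv_rhs => rw [← hd]
    rw [getD_rotate _ _ _ (by omega), Nat.mod_eq_of_lt hm]

theorem exists_primitive_root {T : List ℕ} (hT : T ≠ []) :
    ∃ P k, P ≠ [] ∧ IsPrimitive P ∧ 1 ≤ k ∧ T = strPow P k := by
  induction hn : T.length using Nat.strong_induction_on generalizing T with
  | _ n ih =>
    by_cases hP : IsPrimitive T
    · exact ⟨T, 1, hT, hP, le_rfl, (strPow_one T).symm⟩
    · simp only [IsPrimitive, not_forall, ne_eq, not_not] at hP
      obtain ⟨S, hS, k, hk, rfl⟩ := hP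
      have hS0 := List.length_pos_iff.2 hS
      rw [length_strPow] at hn
      obtain ⟨P, k', h1, h2, h3, h4⟩ := ih S.length (by nlinarith) hS rfl
      exact ⟨P, k' * k, h1, h2, Nat.mul_pos h3 (by omega), by
        rw [h4, strPow_strPow _ h3 (by omega)]⟩

/-- Let a proper suffix y of L = uy be smaller than L. A mismatch would make the rotation yu smaller
than L. Otherwise y is a border, L = yz: then yz < yu gives z < u, so the rotation zy is smaller
than uy = L. -/
theorem isLyndon_of_lt_rotate {L : List ℕ} (hL : L ≠ [])
    (h : ∀ i, 0 < i → i < L.length → L < L.rotate i) : IsLyndon L := by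
  refine ⟨hL, fun i h0 hi => ?_⟩
  by_contra hc
  have hne : L.drop i ≠ L := fun e => by
    have := congrArg List.length e
    simp at this
    omega
  have hlt := lt_of_le_of_ne (not_lt.1 hc) hne
  have hrot := h i h0 hi
  rw [List.rotate_eq_drop_append_take hi.le] at hrot
  rw [List.lt_iff_exists] at hlt
  rcases hlt with ⟨h1, -⟩ | ⟨m, h1, h2, h3, h4⟩
  · have h2 := h (L.length - i) (by omega) (by omega)
    rw [List.rotate_eq_drop_append_take (by omega)] at h2
    rw [List.length_drop] at h1
    rw [← h1] at h2
    have hyu : L.drop (L.length - i) < L.take i := by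
      by_contra hc
      refine absurd hrot (not_lt.2 ?_)
      conv_rhs => rw [← List.take_append_drop (L.length - i) L]
      rw [← h1]
      rcases (not_lt.1 hc).lt_or_eq with h | h
      · exact (append_lt_append_left _ h).le
      · rw [h]
    have := append_lt_append_of_length_le hyu (by simp; omega) (L.drop i) (L.drop i)
    rw [List.take_append_drop] at this
    exact (this.trans h2).false
  · refine absurd hrot (not_lt.2 (lt_of_mismatch m (by simp at *; omega) h2 (fun j hj => ?_) ?_).le)
    · rw [getD_append_left _ _ (by omega), List.getD_eq_getElem _ _ (by omega),
        List.getD_eq_getElem _ _ (by omega), h3 j hj]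
    · rwa [getD_append_left _ _ (by omega), List.getD_eq_getElem _ _ (by omega),
        List.getD_eq_getElem _ _ (by omega)]

/-- Two Lyndon rotations at different indices are proper rotations of each other, so each would have
to be the smaller one. -/
theorem IsLyndon.eq_of_rotate {P : List ℕ} {i j : ℕ} (hi : i < P.length) (hj : j < P.length)
    (hLi : IsLyndon (P.rotate i)) (hLj : IsLyndon (P.rotate j)) : i = j := by
  have aux : ∀ {i j : ℕ}, j < P.length → IsLyndon (P.rotate i) → IsLyndon (P.rotate j) →
      ¬ i < j := by
    intro i j hj hLi hLj hij
    have h1 := hLi.lt_rotate (i := j - i) (by omega) (by simp; omega)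
    have h2 := hLj.le_rotate (P.length - (j - i))
    rw [List.rotate_rotate] at h1 h2
    rw [← List.rotate_mod P (j + _), show j + (P.length - (j - i)) = i + P.length by omega,
      Nat.add_mod_right, List.rotate_mod] at h2
    rw [show i + (j - i) = j by omega] at h1
    exact (h1.trans_le h2).false
  have := aux hj hLi hLj
  have := aux hi hLj hLi
  omega

theorem existsUnique_lyndon_rotate {P : List ℕ} (hP0 : P ≠ []) (hP : IsPrimitive P) :
    ∃! j, j < P.length ∧ IsLyndon (P.rotate j) := by
  have hpos := List.length_pos_iff.2 hP0
  obtain ⟨j, hj, hmin⟩ := Finset.exists_min_image (Finset.range P.length) (fun j => P.rotate j)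
    ⟨0, by simpa using hpos⟩
  rw [Finset.mem_range] at hj
  have hL : IsLyndon (P.rotate j) := by
    refine isLyndon_of_lt_rotate (by simpa using hP0) fun i h0 hi => ?_
    rw [List.length_rotate] at hi
    refine lt_of_le_of_ne ?_ fun e => ?_
    · rw [List.rotate_rotate, ← List.rotate_mod P (j + i)]
      exact hmin _ (by simpa using Nat.mod_lt _ hpos)
    · rw [List.rotate_rotate, add_comm, ← List.rotate_rotate] at e
      exact hP.rotate_ne h0 hi (List.rotate_injective j e).symm
  exact ⟨j, ⟨hj, hL⟩, fun i hi => hi.2.eq_of_rotate hi.1 hj hL⟩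

/-! ### Rows of the sorted matrix and their predecessors -/

/-- The key of the cyclic predecessor of a row. -/
def predKey (S : List ℕ) : Lex (ℕ → ℕ) := key (S.rotate (S.length - 1))

theorem getLastD_eq_omegaPow {S : List ℕ} (hS : S ≠ []) :
    S.getLastD 0 = omegaPow S (S.length - 1) := by
  have := List.length_pos_iff.2 hS
  rw [omegaPow_of_lt (by omega), List.getLastD_eq_getLast?, List.getLast?_eq_getElem?,
    List.getD_eq_getElem?_getD]

theorem omegaPow_pred_zero {S : List ℕ} (hS : S ≠ []) :
    omegaPow (S.rotate (S.length - 1)) 0 = S.getLastD 0 := by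
  rw [omegaPow_rotate, zero_add, getLastD_eq_omegaPow hS]

theorem omegaPow_pred_succ {S : List ℕ} (hS : S ≠ []) (i : ℕ) :
    omegaPow (S.rotate (S.length - 1)) (i + 1) = omegaPow S i := by
  have := List.length_pos_iff.2 hS
  rw [omegaPow_rotate, show i + 1 + (S.length - 1) = i + S.length by omega, omegaPow_add_length]

theorem lexSeq_lt_cons_iff (x y : ℕ → ℕ) : toLex x < toLex y ↔
    x 0 < y 0 ∨ (x 0 = y 0 ∧ toLex (fun i => x (i + 1)) < toLex (fun i => y (i + 1))) := by
  simp only [lexSeq_lt_iff]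
  constructor
  · rintro ⟨l, h1, h2⟩
    cases l with
    | zero => exact Or.inl h2
    | succ l => exact Or.inr ⟨h1 0 (by omega), l, fun i hi => h1 (i + 1) (by omega), h2⟩
  · rintro (h | ⟨h, l, h1, h2⟩)
    · exact ⟨0, by simp, h⟩
    · refine ⟨l + 1, fun i hi => ?_, h2⟩
      cases i with
      | zero => exact h
      | succ i => exact h1 i (by omega)

/-- The infinite power of the predecessor is the last character followed by the infinite power of
the row. -/
theorem predKey_lt_iff {S U : List ℕ} (hS : S ≠ []) (hU : U ≠ []) : predKey S < predKey U ↔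
    S.getLastD 0 < U.getLastD 0 ∨ (S.getLastD 0 = U.getLastD 0 ∧ key S < key U) := by
  rw [predKey, predKey, key, key, lexSeq_lt_cons_iff, omegaPow_pred_zero hS,
    omegaPow_pred_zero hU, funext (omegaPow_pred_succ hS), funext (omegaPow_pred_succ hU)]
  rfl

theorem getLastD_eq_of_key_eq {S U : List ℕ} (hS : S ≠ []) (hU : U ≠ []) (h : key S = key U) :
    S.getLastD 0 = U.getLastD 0 := by
  have hS0 := List.length_pos_iff.2 hS
  have hU0 := List.length_pos_iff.2 hU
  have h' : omegaPow S = omegaPow U := h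
  -- Position `a * b - 1` ends a period of both strings when `a` and `b` are their lengths.
  have aux : ∀ a b : ℕ, 0 < a → 0 < b → (a * b - 1) % a = (a - 1) % a := by
    intro a b ha hb
    obtain ⟨b, rfl⟩ := Nat.exists_eq_succ_of_ne_zero hb.ne'
    rw [Nat.mul_succ, show a * b + a - 1 = a - 1 + a * b by omega, Nat.add_mul_mod_self_left]
  rw [getLastD_eq_omegaPow hS, getLastD_eq_omegaPow hU,
    ← omegaPow_congr_mod S (aux _ _ hS0 hU0), h', mul_comm, omegaPow_congr_mod U (aux _ _ hU0 hS0)]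

/-! ### Sorted lists -/

/-- Repeated factors give rows with equal keys, so the sorted arrangement is not unique. Its image
is, as long as `f` depends on the key only. -/
theorem map_eq_map_of_perm_of_sorted {α κ : Type*} [LinearOrder κ] (k : α → κ) (f : α → ℕ)
    {l₁ l₂ : List α} (hp : l₁.Perm l₂) (h₁ : l₁.Pairwise (fun a b => k a ≤ k b))
    (h₂ : l₂.Pairwise (fun a b => k a ≤ k b))
    (hf : ∀ a ∈ l₁, ∀ b ∈ l₁, k a = k b → f a = f b) : l₁.map f = l₂.map f := by
  have key : l₁.map (fun a => (k a, f a)) = l₂.map (fun a => (k a, f a)) := by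
    refine List.Perm.eq_of_pairwise (le := fun x y => x.1 ≤ y.1) ?_ ?_ ?_ (hp.map _)
    · intro x y hx hy hxy hyx
      obtain ⟨a, ha, rfl⟩ := List.mem_map.1 hx
      obtain ⟨b, hb, rfl⟩ := List.mem_map.1 hy
      have hab := le_antisymm hxy hyx
      exact Prod.ext hab (hf a ha b (hp.mem_iff.2 hb) hab)
    · exact List.pairwise_map.2 h₁
    · exact List.pairwise_map.2 h₂
  simpa [Function.comp_def] using congrArg (List.map Prod.snd) key

theorem take_drop_of_sorted {α κ : Type*} [LinearOrder κ] (k : α → κ) (a : κ) (p : α → Bool)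
    (hp : ∀ x, p x = true ↔ k x < a) : ∀ l : List α, l.Pairwise (fun x y => k x ≤ k y) →
      (∀ x ∈ l.take (l.countP p), k x < a) ∧ ∀ x ∈ l.drop (l.countP p), a ≤ k x
  | [], _ => by simp
  | x :: l, h => by
    rw [List.pairwise_cons] at h
    by_cases hx : k x < a
    · rw [List.countP_cons_of_pos ((hp x).2 hx)]
      simpa [hx] using take_drop_of_sorted k a p hp l h.2
    · have h0 : (x :: l).countP p = 0 := by
        rw [List.countP_eq_zero]
        intro y hy
        rw [hp]
        rcases List.mem_cons.1 hy with rfl | hy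
        · exact hx
        · exact not_lt.2 ((not_lt.1 hx).trans (h.1 y hy))
      rw [h0]
      refine ⟨by simp, fun y hy => ?_⟩
      rcases List.mem_cons.1 hy with rfl | hy
      · exact not_lt.1 hx
      · exact (not_lt.1 hx).trans (h.1 y hy)

theorem insertIdx_eq {α : Type*} (a : α) : ∀ (l : List α) (i : ℕ), i ≤ l.length →
    l.insertIdx i a = l.take i ++ a :: l.drop i
  | _, 0, _ => by simp
  | [], i + 1, h => by simp at h
  | x :: l, i + 1, h => by
    simp only [List.length_cons, add_le_add_iff_right] at h
    simp [insertIdx_eq a l i h]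

/-! ### One insertion -/

/-- `R` is sorted, `r` is its row at index `i` and first among the rows with its key, and `R`
contains the predecessors of all its rows except for `r`, and in addition a row `z` without
successor in `R`. -/
structure InsInv (R : List (List ℕ)) (i : ℕ) (r z : List ℕ) : Prop where
  sorted : R.Pairwise (fun S U => key S ≤ key U)
  ne_nil : ∀ S ∈ R, S ≠ []
  get : R[i]? = some r
  before : ∀ S ∈ R.take i, key S < key r
  perm : (key z :: R.map predKey).Perm (predKey r :: R.map key)

/-- Between two factors the rows are closed under predecessors. A new least row `z` can go in front,
and it is at once the newest row and the row without successor. -/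
theorem insInv_start {R : List (List ℕ)} {z : List ℕ}
    (hs : R.Pairwise (fun S U => key S ≤ key U)) (hne : ∀ S ∈ R, S ≠ [])
    (hp : (R.map predKey).Perm (R.map key)) (hz : z ≠ []) (hmin : ∀ S ∈ R, key z ≤ key S) :
    InsInv (z :: R) 0 z z where
  sorted := List.pairwise_cons.2 ⟨hmin, hs⟩
  ne_nil := by simpa [hz] using hne
  get := rfl
  before := by simp
  perm := by
    simp only [List.map_cons]
    exact (List.Perm.swap _ _ _).trans ((hp.cons _).cons _)

theorem InsInv.perm_of_eq {R : List (List ℕ)} {i : ℕ} {r z : List ℕ} (h : InsInv R i r z)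
    (he : predKey r = key z) : (R.map predKey).Perm (R.map key) := by
  have := h.perm
  rw [he] at this
  exact this.cons_inv

theorem countP_or_of_disjoint {α : Type*} (p q : α → Bool) (l : List α)
    (h : ∀ x ∈ l, ¬ (p x = true ∧ q x = true)) :
    l.countP (fun x => p x || q x) = l.countP p + l.countP q := by
  induction l with
  | nil => rfl
  | cons a l ih =>
    have h1 := h a (by simp)
    have h2 := ih fun x hx => h x (by simp [hx])
    simp only [List.countP_cons, h2]
    cases hp : p a <;> cases hq : q a <;> simp_all <;> omega

-- A predecessor is below `predKey r` if its row has a smaller last character, or the same last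
-- character and a smaller key. By sortedness and `before`, the rows with smaller key are exactly
-- those in front of index `i`, so these numbers are the two summands of LF, up to the one for `r`
-- itself in the rank.
open Classical in
theorem InsInv.countP_key {R : List (List ℕ)} {i : ℕ} {r z : List ℕ} (h : InsInv R i r z)
    (hz : key z < predKey r) :
    R.countP (fun S => decide (key S < predKey r)) =
      LF (R.map (fun S => S.getLastD 0)) (i + 1) := by
  have hirr : ¬ predKey r < predKey r := lt_irrefl (predKey r)
  -- On the side of the predecessors, `key z` contributes one; on the side of the rows, `predKey r`
  -- contributes nothing. This difference accounts for the occurrence in row `r` itself, which the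
  -- rank up to `i + 1` includes.
  have h1 := h.perm.countP_eq (fun a => decide (a < predKey r))
  simp only [List.countP_cons, List.countP_map, hz, hirr, decide_true, decide_false,
    Bool.false_eq_true, if_true, if_false, add_zero] at h1
  have hr : r ≠ [] := h.ne_nil r (List.mem_of_getElem? h.get)
  have hi : i < R.length := by
    by_contra hc
    have := h.get
    rw [List.getElem?_eq_none (by omega)] at this
    cases this
  have hc : charAt (R.map (fun S => S.getLastD 0)) (i + 1) = r.getLastD 0 := by
    simp [charAt, List.getD_eq_getElem?_getD, h.get]
  have hgi : R[i] = r := by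
    have := h.get
    rwa [List.getElem?_eq_getElem hi, Option.some_inj] at this
  have hsplit : R = R.take i ++ R.drop i := (List.take_append_drop i R).symm
  have hdrop : ∀ S ∈ R.drop i, key r ≤ key S := by
    intro S hS
    rw [List.drop_eq_getElem_cons hi, hgi] at hS
    have hs := h.sorted
    rw [hsplit, List.pairwise_append, List.drop_eq_getElem_cons hi, hgi] at hs
    rcases List.mem_cons.1 hS with rfl | hS
    · exact le_rfl
    · exact (List.pairwise_cons.1 hs.2.1).1 S hS
  have e1 : (R.take i).countP (fun S => decide (predKey S < predKey r)) =
      (R.take i).countP (fun S => decide (S.getLastD 0 < r.getLastD 0)) +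
      (R.take i).countP (fun S => S.getLastD 0 == r.getLastD 0) := by
    rw [← countP_or_of_disjoint]
    · refine List.countP_congr fun S hS => ?_
      have := h.before S hS
      simp [predKey_lt_iff (h.ne_nil S (List.mem_of_mem_take hS)) hr, this]
    · intro S hS
      simp only [decide_eq_true_eq, beq_iff_eq, not_and]
      omega
  have e2 : (R.drop i).countP (fun S => decide (predKey S < predKey r)) =
      (R.drop i).countP (fun S => decide (S.getLastD 0 < r.getLastD 0)) := by
    refine List.countP_congr fun S hS => ?_
    have : ¬ key S < key r := (hdrop S hS).not_gt
    simp [predKey_lt_iff (h.ne_nil S (List.mem_of_mem_drop hS)) hr, this]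
  have e3 : rank (R.map (fun S => S.getLastD 0)) (r.getLastD 0) (i + 1) =
      (R.take i).countP (fun S => S.getLastD 0 == r.getLastD 0) + 1 := by
    rw [rank, ← List.map_take, List.take_succ_eq_append_getElem hi, hgi, List.map_append,
      List.count_append, List.count, List.countP_map]
    simp [Function.comp_def]
  have e4 : countSmaller (R.map (fun S => S.getLastD 0)) (r.getLastD 0) =
      R.countP (fun S => decide (S.getLastD 0 < r.getLastD 0)) := by
    rw [countSmaller, List.countP_map]
    rfl
  have e5 : R.countP (fun S => decide (predKey S < predKey r)) =
      (R.take i).countP (fun S => decide (predKey S < predKey r)) +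
      (R.drop i).countP (fun S => decide (predKey S < predKey r)) := by
    rw [← List.countP_append, ← hsplit]
  have e6 : R.countP (fun S => decide (S.getLastD 0 < r.getLastD 0)) =
      (R.take i).countP (fun S => decide (S.getLastD 0 < r.getLastD 0)) +
      (R.drop i).countP (fun S => decide (S.getLastD 0 < r.getLastD 0)) := by
    rw [← List.countP_append, ← hsplit]
  simp only [Function.comp_def] at h1
  rw [LF, hc, e3, e4]
  omega

/-- The predecessor of `r` goes behind exactly the rows with strictly smaller key. This keeps the
order and makes it the first row with its key, as `before` demands for the next step. The index
counts from zero, so LF is not incremented here. -/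
theorem InsInv.step {R : List (List ℕ)} {i : ℕ} {r z : List ℕ} (h : InsInv R i r z)
    (hz : key z < predKey r) :
    LF (R.map (fun S => S.getLastD 0)) (i + 1) ≤ R.length ∧
    InsInv (R.insertIdx (LF (R.map (fun S => S.getLastD 0)) (i + 1)) (r.rotate (r.length - 1)))
      (LF (R.map (fun S => S.getLastD 0)) (i + 1)) (r.rotate (r.length - 1)) z := by
  classical
  obtain ⟨h1, h2⟩ := take_drop_of_sorted key (predKey r) (fun S => decide (key S < predKey r))
    (fun S => decide_eq_true_iff) R h.sorted
  have hr : r ≠ [] := h.ne_nil r (List.mem_of_getElem? h.get)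
  rw [h.countP_key hz] at h1 h2
  have hle : LF (R.map (fun S => S.getLastD 0)) (i + 1) ≤ R.length := by
    rw [← h.countP_key hz]; exact List.countP_le_length
  set q := LF (R.map (fun S => S.getLastD 0)) (i + 1)
  have hperm := List.perm_insertIdx (r.rotate (r.length - 1)) R hle
  refine ⟨hle, ?_, ?_, ?_, ?_, ?_⟩
  · rw [insertIdx_eq _ _ _ hle]
    have hs := h.sorted
    rw [← List.take_append_drop q R, List.pairwise_append] at hs
    rw [List.pairwise_append, List.pairwise_cons]
    refine ⟨hs.1, ⟨h2, hs.2.1⟩, fun S hS U hU => ?_⟩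
    rcases List.mem_cons.1 hU with rfl | hU
    · exact (h1 S hS).le
    · exact hs.2.2 S hS U hU
  · intro S hS
    rcases List.mem_cons.1 (hperm.mem_iff.1 hS) with rfl | hS
    · simpa using hr
    · exact h.ne_nil S hS
  · rw [insertIdx_eq _ _ _ hle, List.getElem?_append_right (by simp)]
    simp [hle]
  · intro S hS
    rw [insertIdx_eq _ _ _ hle, List.take_append_of_le_length (by simp [hle]),
      List.take_take, min_self] at hS
    exact h1 S hS
  · refine ((hperm.map predKey).cons _).trans ?_
    refine List.Perm.trans ?_ ((hperm.map key).symm.cons _)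
    rw [List.map_cons, List.map_cons]
    exact (List.Perm.swap _ _ _).trans (h.perm.cons _)

/-! ### Conjugates -/

theorem perm_conjugates_rotate_one (S : List ℕ) : (conjugates (S.rotate 1)).Perm (conjugates S) := by
  rcases hn : S.length with _ | n
  · simp [conjugates, List.length_eq_zero_iff.1 hn]
  · have e1 : conjugates S = S :: (List.range n).map (fun i => S.rotate (i + 1)) := by
      rw [conjugates, hn, List.range_succ_eq_map]
      simp [Function.comp_def]
    have e2 : conjugates (S.rotate 1) = (List.range n).map (fun i => S.rotate (i + 1)) ++ [S] := by
      rw [conjugates, List.length_rotate, hn, List.range_succ, List.map_append]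
      simp only [List.rotate_rotate, List.map_cons, List.map_nil]
      congr 1
      · simp [add_comm]
      · rw [show 1 + n = S.length by omega, List.rotate_length]
    rw [e1, e2]
    exact List.perm_append_singleton _ _

theorem perm_conjugates_rotate (S : List ℕ) (j : ℕ) :
    (conjugates (S.rotate j)).Perm (conjugates S) := by
  induction j with
  | zero => simp
  | succ j ih =>
    rw [← List.rotate_rotate]
    exact (perm_conjugates_rotate_one _).trans ih

theorem mem_conjugates {S U : List ℕ} (h : U ∈ conjugates S) : ∃ i, U = S.rotate i := by
  obtain ⟨i, -, rfl⟩ := List.mem_map.1 h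
  exact ⟨i, rfl⟩

theorem ne_nil_of_mem_conjugates {S U : List ℕ} (h : U ∈ conjugates S) : U ≠ [] := by
  obtain ⟨i, hi, rfl⟩ := List.mem_map.1 h
  rw [List.mem_range] at hi
  rw [← List.length_pos_iff, List.length_rotate]
  omega

/-! ### The insertion algorithm -/

/-- The invariant between two factors: all conjugates of the processed factors are sorted. -/
def FactorsDone (F : List (List ℕ)) (s : InsState) : Prop :=
  ∃ (done R : List (List ℕ)), s.cur = [] ∧ F = done ++ s.rest ∧ R.Perm (done.flatMap conjugates) ∧
    R.Pairwise (fun S U => key S ≤ key U) ∧ R.map (fun S => S.getLastD 0) = s.built ∧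
    (R.map predKey).Perm (R.map key)

/-- The invariant during a factor. -/
def FactorPartial (F : List (List ℕ)) (s : InsState) (j : ℕ) : Prop :=
  ∃ (done : List (List ℕ)) (f : List ℕ) (R : List (List ℕ)), F = done ++ f :: s.rest ∧ s.cur = f.take j ∧ j < f.length ∧
    R.Perm (done.flatMap conjugates ++
      (List.range' j (f.length - j)).map (fun i => f.rotate (i + 1))) ∧
    R.map (fun S => S.getLastD 0) = s.built ∧ 1 ≤ s.pos ∧
    InsInv R (s.pos - 1) (f.rotate (j + 1)) f

/-- The invariant of the insertion algorithm. -/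
def InsState.Inv (F : List (List ℕ)) (s : InsState) : Prop :=
  FactorsDone F s ∨ ∃ j, 0 < j ∧ FactorPartial F s j

theorem predKey_rotate_succ {f : List ℕ} (hf : f ≠ []) (j : ℕ) :
    (f.rotate (j + 1)).rotate ((f.rotate (j + 1)).length - 1) = f.rotate j := by
  have := List.length_pos_iff.2 hf
  rw [List.length_rotate, List.rotate_rotate, ← List.rotate_mod,
    show j + 1 + (f.length - 1) = j + f.length by omega, Nat.add_mod_right, List.rotate_mod]

/-- For `j = 0` all rotations of the factor are present. The newest row is the rotation by one,
whose predecessor is the factor itself, so the two exceptional entries of `perm` cancel. -/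
theorem FactorPartial.inv {F : List (List ℕ)} {s : InsState} {j : ℕ}
    (h : FactorPartial F s j) : s.Inv F := by
  rcases Nat.eq_zero_or_pos j with rfl | hj
  · obtain ⟨done, f, R, h1, h2, h3, h4, h5, h6, h7⟩ := h
    have hf : f ≠ [] := List.length_pos_iff.1 h3
    refine Or.inl ⟨done ++ [f], R, by simpa using h2, by simp [h1], h4.trans ?_, h7.sorted, h5,
      h7.perm_of_eq ?_⟩
    · rw [List.flatMap_append]
      refine List.Perm.append_left _ ?_
      have := perm_conjugates_rotate f 1
      rw [conjugates] at this
      simpa only [List.flatMap_cons, List.flatMap_nil, List.append_nil, List.range_eq_range',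
        Nat.sub_zero, List.length_rotate, funext (List.rotate_rotate f 1), add_comm 1] using this
    · rw [predKey, predKey_rotate_succ hf, List.rotate_zero]
  · exact Or.inr ⟨j, hj, h⟩

/-- The new factor is at most every earlier one, hence, as infinite powers, at most every conjugate
of an earlier one. Position one is therefore correct. -/
theorem FactorsDone.next {F : List (List ℕ)} {s : InsState} (h : FactorsDone F s)
    (hL : ∀ f ∈ F, IsLyndon f) (hF : F.Pairwise (fun f g => g ≤ f)) {f : List ℕ}
    {G : List (List ℕ)} (hr : s.rest = f :: G) :
    s.next = ⟨f.getLastD 0 :: s.built, 1, f.dropLast, G⟩ ∧ s.next.Inv F := by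
  obtain ⟨done, R, h1, h2, h3, h4, h5, h6⟩ := h
  have hn : s.next = ⟨f.getLastD 0 :: s.built, 1, f.dropLast, G⟩ := by
    rw [InsState.next, h1, hr]
  refine ⟨hn, ?_⟩
  rw [hn]
  have hf := hL f (by simp [h2, hr])
  have hpos := hf.length_pos
  refine FactorPartial.inv (j := f.length - 1)
    ⟨done, f, f :: R, by rw [h2, hr], List.dropLast_eq_take, by omega, ?_, ?_, le_rfl, ?_⟩
  · rw [show f.length - (f.length - 1) = 1 by omega]
    simp only [List.range'_one, List.map_cons, List.map_nil]
    rw [show f.length - 1 + 1 = f.length by omega, List.rotate_length]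
    exact (h3.cons f).trans (List.perm_append_singleton _ _).symm
  · rw [List.map_cons, h5]
  · rw [show f.length - 1 + 1 = f.length by omega, List.rotate_length]
    refine insInv_start h4 ?_ h6 hf.1 ?_
    · intro S hS
      obtain ⟨g, -, hS⟩ := List.mem_flatMap.1 (h3.mem_iff.1 hS)
      exact ne_nil_of_mem_conjugates hS
    · intro S hS
      obtain ⟨g, hg, hS⟩ := List.mem_flatMap.1 (h3.mem_iff.1 hS)
      obtain ⟨i, rfl⟩ := mem_conjugates hS
      have hgL := hL g (by simp [h2, hg])
      have hfg : f ≤ g := by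
        rw [h2, hr, List.pairwise_append] at hF
        exact hF.2.2 g hg f (by simp)
      exact (key_le_key_of_le hf.1 hgL hfg).trans (hgL.key_le_key_rotate i)

theorem FactorPartial.next {F : List (List ℕ)} {s : InsState} {j : ℕ} (h : FactorPartial F s j)
    (hj : 0 < j) (hL : ∀ f ∈ F, IsLyndon f) :
    s.next = ⟨s.built.insertIdx (LF s.built s.pos) (s.cur.getLastD 0), LF s.built s.pos + 1,
      s.cur.dropLast, s.rest⟩ ∧ s.cur ≠ [] ∧ 1 ≤ s.pos ∧ s.pos ≤ s.built.length ∧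
      LF s.built s.pos ≤ s.built.length ∧ s.next.Inv F := by
  obtain ⟨done, f, R, h1, h2, h3, h4, h5, h6, h7⟩ := h
  obtain ⟨j, rfl⟩ := Nat.exists_eq_succ_of_ne_zero hj.ne'
  have hf := hL f (by simp [h1])
  have hcur : s.cur ≠ [] := by
    rw [h2, ← List.length_pos_iff]; simp; omega
  have hn : s.next = ⟨s.built.insertIdx (LF s.built s.pos) (s.cur.getLastD 0),
      LF s.built s.pos + 1, s.cur.dropLast, s.rest⟩ := by
    rw [InsState.next]
    split
    · contradiction
    · simp_all
  have hlen : R.length = s.built.length := by rw [← h5, List.length_map]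
  have hk : key f < predKey (f.rotate (j + 1 + 1)) := by
    rw [predKey, predKey_rotate_succ hf.1]
    exact hf.key_lt_key_rotate (by omega) h3
  obtain ⟨hle, hinv⟩ := h7.step hk
  rw [predKey_rotate_succ hf.1, h5, show s.pos - 1 + 1 = s.pos by omega] at hinv
  rw [h5, show s.pos - 1 + 1 = s.pos by omega] at hle
  refine ⟨hn, hcur, h6, ?_, by omega, ?_⟩
  · by_contra hc
    have := h7.get
    rw [List.getElem?_eq_none (by omega)] at this
    cases this
  rw [hn]
  refine FactorPartial.inv (j := j) ⟨done, f, _, h1, ?_, by omega, ?_, ?_, by simp, hinv⟩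
  · rw [h2, List.dropLast_take (by omega)]
    rfl
  · refine (List.perm_insertIdx _ _ hle).trans ((h4.cons _).trans ?_)
    rw [show f.length - j = f.length - (j + 1) + 1 by omega, List.range'_succ, List.map_cons]
    exact List.perm_middle.symm
  · rw [List.map_insertIdx, h5]
    congr 1
    -- The new row is `f.rotate (j + 1)`, which ends with the character of `f` at index `j`; this is
    -- the last one in `f.take (j + 1)`.
    rw [h2, getLastD_eq_omegaPow (by simpa using hf.1), List.length_rotate, omegaPow_rotate,
      show f.length - 1 + (j + 1) = j + f.length by omega, omegaPow_add_length,
      omegaPow_of_lt (by omega), List.getLastD_eq_getLast?, List.getLast?_eq_getElem?,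
      List.getD_eq_getElem?_getD, List.length_take, min_eq_left (by omega)]
    simp

theorem insState_succ (T : List ℕ) (i : ℕ) : insState T (i + 1) = (insState T i).next := by
  rw [insState, Function.iterate_succ_apply']
  rfl

/-- The state of the algorithm after `i ≤ |T|` insertions. -/
theorem insState_inv (T : List ℕ) {i : ℕ} (hi : i ≤ T.length) :
    (insState T i).Inv (lyndonFactors T) ∧ (insState T i).built.length = i ∧
    i + (insState T i).cur.length + (insState T i).rest.flatten.length = T.length := by
  obtain ⟨hT, hL, hF⟩ := lyndonFactors_spec T
  induction i with
  | zero =>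
    refine ⟨Or.inl ⟨[], [], rfl, rfl, by simp, by simp, rfl, by simp⟩, rfl, ?_⟩
    simp only [insState, Function.iterate_zero, id, hT]
    simp
  | succ i ih =>
    obtain ⟨h1, h2, h3⟩ := ih (by omega)
    rw [insState_succ]
    rcases h1 with h1 | ⟨j, hj, h1⟩
    · have hcur : (insState T i).cur = [] := by
        obtain ⟨_, _, h, _⟩ := h1; exact h
      rcases hr : (insState T i).rest with _ | ⟨f, G⟩
      · rw [hcur, hr] at h3
        simp at h3
        omega
      · obtain ⟨hn, hinv⟩ := h1.next hL hF hr
        have hf : 0 < f.length := by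
          obtain ⟨done, _, _, h, _⟩ := h1
          exact (hL f (by simp [h, hr])).length_pos
        refine ⟨hinv, by rw [hn]; simp [h2], ?_⟩
        rw [hn]
        rw [hcur, hr] at h3
        simp at h3 ⊢
        omega
    · obtain ⟨hn, hc, -, -, hle, hinv⟩ := h1.next hj hL
      refine ⟨hinv, ?_, ?_⟩
      · rw [hn]
        simp only
        rw [List.length_insertIdx_of_le_length hle, h2]
      · rw [hn]
        have := List.length_pos_iff.2 hc
        simp at h3 ⊢
        omega

/-! ### The transforms -/

theorem exists_bbwt_rows (T : List ℕ) : ∃ R : List (List ℕ),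
    bbwt T = R.map (fun S => S.getLastD 0) ∧ R.Perm ((lyndonFactors T).flatMap conjugates) ∧
      R.Pairwise (fun S U => key S ≤ key U) := by
  have e : ∀ S U, ¬ OmegaLT U S ↔ key S ≤ key U := fun S U =>
    not_lt (a := key U) (b := key S)
  have : Std.Total (fun S U => ¬ OmegaLT U S) :=
    ⟨fun S U => by simp only [e]; exact le_total _ _⟩
  have : IsTrans (List ℕ) (fun S U => ¬ OmegaLT U S) :=
    ⟨fun S U V => by simp only [e]; exact le_trans⟩
  classical
  exact ⟨_, rfl, List.perm_insertionSort _ _,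
    (List.pairwise_insertionSort _ _).imp fun {S U} h => (e S U).1 h⟩

theorem insState_built (T : List ℕ) : (insState T T.length).built = bbwt T := by
  obtain ⟨hT, hL, hF⟩ := lyndonFactors_spec T
  obtain ⟨h1, -, h3⟩ := insState_inv T le_rfl
  rcases h1 with ⟨done, R, -, h4, h5, h6, h7, -⟩ | ⟨j, hj, h1⟩
  · have hrest : (insState T T.length).rest = [] := by
      rcases hr : (insState T T.length).rest with _ | ⟨f, G⟩
      · rfl
      · have := (hL f (by simp [h4, hr])).length_pos
        rw [hr] at h3
        simp at h3
        omega
    rw [hrest, List.append_nil] at h4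
    obtain ⟨R', e, hp, hs⟩ := exists_bbwt_rows T
    rw [← h7, e]
    refine map_eq_map_of_perm_of_sorted key _ ?_ h6 hs ?_
    · rw [h4] at hp
      exact h5.trans hp.symm
    · intro S hS U hU
      obtain ⟨_, -, hS⟩ := List.mem_flatMap.1 (h5.mem_iff.1 hS)
      obtain ⟨_, -, hU⟩ := List.mem_flatMap.1 (h5.mem_iff.1 hU)
      exact getLastD_eq_of_key_eq (ne_nil_of_mem_conjugates hS) (ne_nil_of_mem_conjugates hU)
  · have := (h1.next hj hL).2.1
    have := List.length_pos_iff.2 this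
    omega

theorem insLayout_length (T : List ℕ) : insLayout T T.length = bbwt T := by
  obtain ⟨-, -, h⟩ := insState_inv T le_rfl
  have h1 : (insState T T.length).cur = [] := List.length_eq_zero_iff.1 (by omega)
  have h2 : (insState T T.length).rest.flatten = [] := List.length_eq_zero_iff.1 (by omega)
  rw [insLayout, insState_built, h1, h2, List.append_nil, List.append_nil]

theorem insLayout_zero (T : List ℕ) : insLayout T 0 = T := by
  simp [insLayout, insState, (lyndonFactors_spec T).1]

theorem length_insLayout (T : List ℕ) {i : ℕ} (hi : i ≤ T.length) :
    (insLayout T i).length = T.length := by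
  obtain ⟨-, h1, h2⟩ := insState_inv T hi
  rw [insLayout, List.length_append, List.length_append]
  omega

theorem bwtc_rotate (S : List ℕ) (j : ℕ) : bwtc (S.rotate j) = bwtc S := by
  rw [bwtc, bwtc]
  congr 1
  refine List.Perm.eq_of_pairwise (le := (· ≤ ·)) (fun _ _ _ _ => le_antisymm)
    (List.pairwise_insertionSort _ _) (List.pairwise_insertionSort _ _) ?_
  exact (List.perm_insertionSort _ _).trans ((perm_conjugates_rotate S j).trans
    (List.perm_insertionSort _ _).symm)

theorem IsLyndon.bwtc_eq_bbwt {T : List ℕ} (h : IsLyndon T) : bwtc T = bbwt T := by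
  obtain ⟨R, e, hp, hs⟩ := exists_bbwt_rows T
  rw [h.lyndonFactors, List.flatMap_cons, List.flatMap_nil, List.append_nil] at hp
  rw [bwtc, e, lastChars]
  refine map_eq_map_of_perm_of_sorted key _ ?_ ?_ hs ?_
  · exact (List.perm_insertionSort _ _).trans hp.symm
  · refine List.Pairwise.imp_of_mem ?_ (List.pairwise_insertionSort (· ≤ ·) (conjugates T))
    intro S U hS hU hSU
    rw [List.mem_insertionSort] at hS hU
    obtain ⟨i, rfl⟩ := mem_conjugates hS
    obtain ⟨i', rfl⟩ := mem_conjugates hU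
    exact (key_le_key (by simp)).2 hSU
  · intro S hS U hU
    rw [List.mem_insertionSort] at hS hU
    exact getLastD_eq_of_key_eq (ne_nil_of_mem_conjugates hS) (ne_nil_of_mem_conjugates hU)

theorem perm_conjugates_strPow (P : List ℕ) (k : ℕ) :
    (conjugates (strPow P k)).Perm
      ((conjugates P).flatMap (fun S => List.replicate k (strPow S k))) := by
  have e : conjugates (strPow P k) =
      (List.range (k * P.length)).map (fun i => strPow (P.rotate i) k) := by
    rw [conjugates, length_strPow]
    exact List.map_congr_left fun i _ => rotate_strPow P k i
  -- The exponent `k` inside the rows stays fixed, and the induction is on the number `m` of blocks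
  -- of `P.length` rotations. Each block contributes every conjugate once, because rotating `P`
  -- depends only on the index modulo `P.length`.
  have aux : ∀ m, ((List.range (m * P.length)).map (fun i => strPow (P.rotate i) k)).Perm
      ((conjugates P).flatMap (fun S => List.replicate m (strPow S k))) := by
    intro m
    induction m with
    | zero => simp
    | succ m ih =>
      rw [Nat.succ_mul, List.range_add, List.map_append, List.map_map]
      have e2 : (List.range P.length).map
          ((fun i => strPow (P.rotate i) k) ∘ fun x => m * P.length + x) =
          (conjugates P).map (fun S => strPow S k) := by
        rw [conjugates, List.map_map]
        refine List.map_congr_left fun i _ => ?_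
        simp only [Function.comp]
        rw [← List.rotate_rotate, ← List.rotate_mod P (m * P.length)]
        simp
      rw [e2]
      refine (ih.append_right _).trans ?_
      simp only [List.replicate_succ]
      refine List.perm_append_comm.trans ?_
      rw [List.map_eq_flatMap]
      refine (List.flatMap_append_perm _ _ _).trans (List.Perm.of_eq ?_)
      simp
  rw [e]
  exact aux k

theorem bwtc_strPow (P : List ℕ) {k : ℕ} (hk : 1 ≤ k) :
    bwtc (strPow P k) = expandRuns k (bwtc P) := by
  have e : expandRuns k (bwtc P) = (((conjugates P).insertionSort (· ≤ ·)).flatMap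
      (fun S => List.replicate k (strPow S k))).map (fun S => S.getLastD 0) := by
    rw [expandRuns, bwtc, lastChars, List.flatMap_map, List.map_flatMap]
    refine List.flatMap_congr fun S hS => ?_
    rw [List.map_replicate]
    congr 1
    rw [List.mem_insertionSort] at hS
    have hS := ne_nil_of_mem_conjugates hS
    refine getLastD_eq_of_key_eq hS ?_ ?_
    · have := List.length_pos_iff.2 hS
      rw [← List.length_pos_iff, length_strPow]
      positivity
    · rw [key, key, omegaPow_strPow _ hk]
  rw [e, bwtc, lastChars]
  congr 1
  refine List.Perm.eq_of_pairwise (le := (· ≤ ·)) (fun _ _ _ _ => le_antisymm)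
    (List.pairwise_insertionSort _ _) ?_ ?_
  · rw [List.pairwise_flatMap]
    refine ⟨fun S _ => List.pairwise_replicate.2 (Or.inr le_rfl), ?_⟩
    refine List.Pairwise.imp_of_mem ?_ (List.pairwise_insertionSort (· ≤ ·) (conjugates P))
    intro S U hS hU hSU x hx y hy
    rw [List.mem_insertionSort] at hS hU
    obtain ⟨i, rfl⟩ := mem_conjugates hS
    obtain ⟨i', rfl⟩ := mem_conjugates hU
    rw [List.eq_of_mem_replicate hx, List.eq_of_mem_replicate hy,
      ← key_le_key (by simp [length_strPow]), key, key, omegaPow_strPow _ hk, omegaPow_strPow _ hk]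
    exact (key_le_key (by simp)).2 hSU
  · refine (List.perm_insertionSort _ _).trans ((perm_conjugates_strPow P k).trans ?_)
    exact (List.perm_insertionSort _ _).symm.flatMap_right _

/-! ### Reasoning about programs -/

section Machine

variable {r w σ : ℕ}

theorem run_add (s t : ℕ) (c : Config r) :
    run w σ (s + t) c = (run w σ s c).bind (run w σ t) := by
  induction s generalizing c with
  | zero => simp [run]
  | succ s ih =>
    rw [Nat.succ_add, run, run]
    cases step w σ c with
    | none => rfl
    | some c => exact ih c

theorem run_trans {s t : ℕ} {c c' c'' : Config r} (h : run w σ s c = some c')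
    (h' : run w σ t c' = some c'') : run w σ (s + t) c = some c'' := by
  rw [run_add, h]
  exact h'

theorem run_one {c c' : Config r} (h : step w σ c = some c') : run w σ 1 c = some c' := by
  rw [run, h]
  rfl

/-- Started with registers `g` and text `A`, the program finishes without fault after at most `t`
steps, with registers and text that satisfy `Q`. -/
def Exec (w σ : ℕ) (p : Prog r) (t : ℕ) (g : Fin (r + 1) → ℕ) (A : List ℕ)
    (Q : (Fin (r + 1) → ℕ) → List ℕ → Prop) : Prop :=
  ∃ s ≤ t, ∃ g' A', (∀ K, run w σ s ⟨p :: K, g, A⟩ = some ⟨K, g', A'⟩) ∧ Q g' A'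

variable {p q : Prog r} {t t' : ℕ} {g : Fin (r + 1) → ℕ} {A : List ℕ}
  {Q Q' : (Fin (r + 1) → ℕ) → List ℕ → Prop} {x y z : Fin (r + 1)} {b : Cond r}

theorem Exec.mono (h : Exec w σ p t g A Q) (ht : t ≤ t') (hQ : ∀ g A, Q g A → Q' g A) :
    Exec w σ p t' g A Q' := by
  obtain ⟨s, hs, g', A', h1, h2⟩ := h
  exact ⟨s, hs.trans ht, g', A', h1, hQ _ _ h2⟩

theorem Exec.weaken (h : Exec w σ p t g A Q) (ht : t ≤ t') : Exec w σ p t' g A Q :=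
  h.mono ht fun _ _ h => h

theorem exec_skip (h : Q g A) : Exec w σ .skip 1 g A Q :=
  ⟨1, le_rfl, g, A, fun _ => run_one rfl, h⟩

theorem run_writeReg {c : Config r} {K : List (Prog r)} {v : ℕ} (hv : v < 2 ^ w)
    (h : step w σ c = writeReg w K g A x v) :
    run w σ 1 c = some ⟨K, Function.update g x v, A⟩ := by
  apply run_one
  rw [h, writeReg, if_pos hv]

theorem exec_const {v : ℕ} (hv : v < 2 ^ w) (h : Q (Function.update g x v) A) :
    Exec w σ (.const x v) 1 g A Q :=
  ⟨1, le_rfl, _, A, fun _ => run_writeReg hv rfl, h⟩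

theorem exec_copy (hv : g y < 2 ^ w) (h : Q (Function.update g x (g y)) A) :
    Exec w σ (.copy x y) 1 g A Q :=
  ⟨1, le_rfl, _, A, fun _ => run_writeReg hv rfl, h⟩

theorem exec_add (hv : g y + g z < 2 ^ w) (h : Q (Function.update g x (g y + g z)) A) :
    Exec w σ (.add x y z) 1 g A Q :=
  ⟨1, le_rfl, _, A, fun _ => run_writeReg hv rfl, h⟩

theorem exec_sub (hv : g y - g z < 2 ^ w) (h : Q (Function.update g x (g y - g z)) A) :
    Exec w σ (.sub x y z) 1 g A Q :=
  ⟨1, le_rfl, _, A, fun _ => run_writeReg hv rfl, h⟩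

theorem exec_load (hy : g y < A.length) (hv : A.getD (g y) 0 < 2 ^ w)
    (h : Q (Function.update g x (A.getD (g y) 0)) A) : Exec w σ (.load x y) 1 g A Q := by
  refine ⟨1, le_rfl, _, A, fun K => run_writeReg hv ?_, h⟩
  simp only [step]
  rw [List.getElem?_eq_getElem hy, List.getD_eq_getElem _ _ hy]

theorem exec_store (hx : g x < A.length) (hy : g y < σ) (h : Q g (A.set (g x) (g y))) :
    Exec w σ (.store x y) 1 g A Q := by
  refine ⟨1, le_rfl, g, _, fun K => run_one ?_, h⟩
  simp only [step]
  rw [if_pos ⟨hx, hy⟩]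

theorem exec_seq (h : Exec w σ p t g A (fun g' A' => Exec w σ q t' g' A' Q)) :
    Exec w σ (.seq p q) (t' + t + 1) g A Q := by
  obtain ⟨s, hs, g', A', h1, s', hs', g'', A'', h2, h3⟩ := h
  exact ⟨1 + s + s', by omega, g'', A'',
    fun K => run_trans (run_trans (run_one rfl) (h1 _)) (h2 K), h3⟩

theorem exec_cons (h : Exec w σ p 1 g A (fun g' A' => Exec w σ q t g' A' Q)) :
    Exec w σ (.seq p q) (t + 2) g A Q := exec_seq h

theorem exec_ite (h1 : b.holds g = true → Exec w σ p t g A Q)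
    (h2 : b.holds g = false → Exec w σ q t g A Q) : Exec w σ (.ite b p q) (t + 1) g A Q := by
  have hstep : ∀ K, step w σ ⟨.ite b p q :: K, g, A⟩ =
    some ⟨(if b.holds g then p else q) :: K, g, A⟩ := fun _ => rfl
  cases hb : b.holds g
  · obtain ⟨s, hs, g', A', h3, h4⟩ := h2 hb
    refine ⟨1 + s, by omega, g', A', fun K => run_trans (run_one (hstep K)) ?_, h4⟩
    rw [hb]; exact h3 K
  · obtain ⟨s, hs, g', A', h3, h4⟩ := h1 hb
    refine ⟨1 + s, by omega, g', A', fun K => run_trans (run_one (hstep K)) ?_, h4⟩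
    rw [hb]; exact h3 K

theorem run_loop_false (hb : b.holds g = false) (K : List (Prog r)) :
    run w σ 1 ⟨.loop b p :: K, g, A⟩ = some ⟨K, g, A⟩ := by
  apply run_one
  simp [step, hb]

theorem run_loop_true (hb : b.holds g = true) (K : List (Prog r)) :
    run w σ 1 ⟨.loop b p :: K, g, A⟩ = some ⟨p :: .loop b p :: K, g, A⟩ := by
  apply run_one
  simp [step, hb]

/-- A loop with an invariant `I k`, where `k` bounds the number of remaining iterations. -/
theorem exec_loop {d : ℕ} (I : ℕ → (Fin (r + 1) → ℕ) → List ℕ → Prop)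
    (h : ∀ k g A, I k g A → (b.holds g = false ∧ Q g A) ∨
      (b.holds g = true ∧ ∃ k', k = k' + 1 ∧ Exec w σ p d g A (I k'))) {k : ℕ} (h0 : I k g A) :
    Exec w σ (.loop b p) (k * (d + 1) + 1) g A Q := by
  induction k generalizing g A with
  | zero =>
    rcases h 0 g A h0 with ⟨h1, h2⟩ | ⟨-, k', h1, -⟩
    · exact ⟨1, by omega, g, A, fun K => run_loop_false h1 K, h2⟩
    · omega
  | succ k ih =>
    rcases h _ g A h0 with ⟨h1, h2⟩ | ⟨h1, k', h2, s, hs, g', A', h3, h4⟩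
    · exact ⟨1, by omega, g, A, fun K => run_loop_false h1 K, h2⟩
    · obtain rfl : k = k' := by omega
      obtain ⟨s', hs', g'', A'', h5, h6⟩ := ih h4
      refine ⟨1 + s + s', by rw [Nat.succ_mul]; omega, g'', A'', fun K =>
        run_trans (run_trans (run_loop_true h1 K) (h3 _)) (h5 K), h6⟩

/-- The times at which a loop with a prescribed sequence of invariants starts its iterations. -/
theorem exists_loop_times {d N : ℕ} (I : ℕ → (Fin (r + 1) → ℕ) → List ℕ → Prop)
    (hb : ∀ i < N, ∀ g A, I i g A → b.holds g = true ∧ Exec w σ p d g A (I (i + 1)))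
    (h0 : I 0 g A) : ∃ τ : ℕ → ℕ, τ 0 = 0 ∧
      (∀ i < N, τ i < τ (i + 1) ∧ τ (i + 1) ≤ τ i + (d + 1)) ∧
      ∀ i ≤ N, ∃ g' A', I i g' A' ∧
        ∀ K, run w σ (τ i) ⟨.loop b p :: K, g, A⟩ = some ⟨.loop b p :: K, g', A'⟩ := by
  induction N with
  | zero =>
    refine ⟨fun _ => 0, rfl, by simp, fun i hi => ?_⟩
    obtain rfl : i = 0 := by omega
    exact ⟨g, A, h0, fun K => rfl⟩
  | succ N ih =>
    obtain ⟨τ, hτ0, hτ1, hτ2⟩ := ih fun i hi => hb i (by omega)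
    obtain ⟨g', A', h1, h2⟩ := hτ2 N le_rfl
    obtain ⟨h3, s, hs, g'', A'', h4, h5⟩ := hb N (by omega) g' A' h1
    refine ⟨fun i => if i ≤ N then τ i else τ N + (1 + s), by simpa using hτ0, fun i hi => ?_,
      fun i hi => ?_⟩
    · rcases lt_or_ge i N with h | h
      · simpa [h.le, Nat.succ_le_of_lt h] using hτ1 i h
      · obtain rfl : i = N := by omega
        simp
        omega
    · rcases Nat.lt_or_ge N i with h | h
      · obtain rfl : i = N + 1 := by omega
        refine ⟨g'', A'', h5, fun K => ?_⟩
        simp only [show ¬ N + 1 ≤ N by omega, if_false]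
        exact run_trans (h2 K) (run_trans (run_loop_true h3 K) (h4 _))
      · simpa [h] using hτ2 i h

/-- Both claims about a program come from one invariant, indexed by the number of completed
insertions. The times asked for in `PerformsInsertions` are those at which control is at the head of
the loop. -/
theorem performsInsertions_and_haltsWith {pre post body : Prog r} {T L out : List ℕ}
    {tpre d tpost : ℕ} (I : ℕ → (Fin (r + 1) → ℕ) → List ℕ → Prop)
    (hpre : Exec w σ pre tpre (fun x => if x = 0 then T.length else 0) T (I 0))
    (hbody : ∀ i < L.length, ∀ g A, I i g A →
      b.holds g = true ∧ Exec w σ body d g A (I (i + 1)))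
    (hend : ∀ g A, I L.length g A → b.holds g = false ∧
      Exec w σ post tpost g A (fun _ A' => A' = out))
    (hI : ∀ i ≤ L.length, ∀ g A, I i g A → insLayout L i <+: A) :
    PerformsInsertions w σ (.seq pre (.seq (.loop b body) post)) T L (d + 1) ∧
    HaltsWith w σ (.seq pre (.seq (.loop b body) post)) T
      (tpre + L.length * (d + 1) + tpost + 3) out := by
  obtain ⟨s, hs, g, A, h1, h2⟩ := hpre
  obtain ⟨τ, hτ0, hτ1, hτ2⟩ := exists_loop_times I hbody h2
  have hstart : run w σ (1 + s + 1) (startConfig (.seq pre (.seq (.loop b body) post)) T) =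
      some ⟨[.loop b body, post], g, A⟩ :=
    run_trans (run_trans (run_one rfl) (h1 _)) (run_one rfl)
  refine ⟨⟨fun i => 1 + s + 1 + τ i, fun i hi => ?_, fun i hi => ?_⟩, ?_⟩
  · have := hτ1 i hi
    dsimp only
    omega
  · obtain ⟨g', A', h3, h4⟩ := hτ2 i hi
    exact ⟨_, run_trans hstart (h4 _), hI i hi g' A' h3⟩
  · obtain ⟨g', A', h3, h4⟩ := hτ2 _ le_rfl
    obtain ⟨h5, s', hs', g'', A'', h6, h7⟩ := hend g' A' h3
    have hτ : ∀ i ≤ L.length, τ i ≤ i * (d + 1) := by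
      intro i hi
      induction i with
      | zero => omega
      | succ i ih =>
        have h8 := ih (by omega)
        have h9 := hτ1 i (by omega)
        rw [Nat.succ_mul]
        omega
    have := hτ _ le_rfl
    exact ⟨1 + s + 1 + τ L.length + 1 + s', by omega, ⟨[], g'', A''⟩,
      run_trans (run_trans (run_trans hstart (h4 _)) (run_loop_false h5 _)) (h6 _), rfl, h7⟩

end Machine

/-! ### The programs

Register `0` holds the length of the text, `1` the number one, `2` the number zero, `3` the length
of the region that is transformed, `4` the number of insertions done, `5` the number of characters
of the current factor that are not inserted, `6` and `7` the indices of the last and the next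
inserted character, `8` and `9` the two pointers of Duval's scan, `10` and `11` characters, `12`
the flag that ends Duval's scan, `13` a pointer, `14` a character or a remainder, `15` the exponent
of the text, and `16` the flag that ends the search for the Lyndon conjugate. -/

/-- One comparison of Duval's scan. -/
def duvalBody : Prog 16 :=
  .ite (.lt 9 3)
    (.seq (.load 10 8) (.seq (.load 11 9)
      (.ite (.lt 10 11) (.seq (.copy 8 4) (.add 9 9 1))
        (.ite (.eq 10 11) (.seq (.add 8 8 1) (.add 9 9 1)) (.copy 12 1)))))
    (.copy 12 1)

/-- Duval's scan on the cells from register `4` up to register `3`. -/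
def duval : Prog 16 :=
  .seq (.copy 8 4) (.seq (.add 9 4 1) (.seq (.copy 12 2) (.loop (.eq 12 2) duvalBody)))

theorem getD_middle (X s Z : List ℕ) {i : ℕ} (hi : i < s.length) :
    (X ++ s ++ Z).getD (X.length + i) 0 = s.getD i 0 := by
  rw [getD_append_left _ _ (by simp; omega), getD_append_right _ _ (by omega),
    Nat.add_sub_cancel_left]

theorem getD_lt_of_forall {A : List ℕ} {B i : ℕ} (h : ∀ c ∈ A, c < B) (hi : i < A.length) :
    A.getD i 0 < B := by
  rw [List.getD_eq_getElem _ _ hi]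
  exact h _ (List.getElem_mem hi)

/-- While the flag is zero, each iteration advances the pointer `j` or sets the flag, so `s.length +
1 - j` bounds the remaining iterations. The text `Z` lies behind the region and is never read. -/
theorem exec_duval {w σ : ℕ} {g : Fin 17 → ℕ} {X s Z : List ℕ} (hs : s ≠ [])
    (h1 : g 1 = 1) (h2 : g 2 = 0) (h4 : g 4 = X.length) (h3 : g 3 = X.length + s.length)
    (hA : ∀ c ∈ X ++ s ++ Z, c < 2 ^ w) (hw : X.length + s.length + 1 < 2 ^ w) :
    Exec w σ duval (13 * s.length + 20) g (X ++ s ++ Z) (fun g' A' => A' = X ++ s ++ Z ∧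
      (∀ x, x ≠ 8 → x ≠ 9 → x ≠ 10 → x ≠ 11 → x ≠ 12 → g' x = g x) ∧
      ∃ j k, g' 8 = X.length + k ∧ g' 9 = X.length + j ∧ DuvalInv s j k ∧
        (j = s.length ∨ s.getD j 0 < s.getD k 0)) := by
  have hs0 := List.length_pos_iff.2 hs
  have h1w : 1 < 2 ^ w := by omega
  -- At most 12 steps per body and one per test, one for the failing test, and two for each of the
  -- three assignments.
  refine Exec.weaken (t := s.length * (12 + 1) + 1 + 6) ?_ (by omega)
  unfold duval
  refine exec_cons (exec_copy (by omega) ?_)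
  refine exec_cons (exec_add (by simp; omega) ?_)
  refine exec_cons (exec_copy (by simp; omega) ?_)
  refine exec_loop (fun m g' A' => A' = X ++ s ++ Z ∧
      (∀ x, x ≠ 8 → x ≠ 9 → x ≠ 10 → x ≠ 11 → x ≠ 12 → g' x = g x) ∧
      ∃ j k, g' 8 = X.length + k ∧ g' 9 = X.length + j ∧ DuvalInv s j k ∧
        ((g' 12 = 0 ∧ m + j = s.length + 1) ∨
          (g' 12 = 1 ∧ (j = s.length ∨ s.getD j 0 < s.getD k 0)))) ?_ ?_
  · rintro m g' A' ⟨rfl, hf, j, k, e8, e9, hD, ⟨e12, hm⟩ | ⟨e12, hend⟩⟩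
    · have e1 : g' 1 = 1 := by rw [hf] <;> simp [h1]
      have e2 : g' 2 = 0 := by rw [hf] <;> simp [h2]
      have e3 : g' 3 = X.length + s.length := by rw [hf] <;> simp [h3]
      have e4 : g' 4 = X.length := by rw [hf] <;> simp [h4]
      have hkj := hD.lt
      have hjs := hD.le
      have hk := getD_lt_of_forall hA (i := X.length + k) (by simp; omega)
      rw [getD_middle _ _ _ (by omega)] at hk
      refine Or.inr ⟨by simp [Cond.holds, e12, e2], s.length - j, by omega, ?_⟩
      refine exec_ite (t := 11) (fun hb => ?_) (fun hb => ?_)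
      · have hj : j < s.length := by simpa [Cond.holds, e9, e3] using hb
        have hjA := getD_lt_of_forall hA (i := X.length + j) (by simp; omega)
        rw [getD_middle _ _ _ hj] at hjA
        refine exec_cons (exec_load (by rw [e8]; simp; omega)
          (by rw [e8, getD_middle _ _ _ (by omega)]; exact hk) ?_)
        rw [e8, getD_middle _ _ _ (by omega)]
        refine exec_cons (exec_load (by simp [e9]; omega)
          (by simp only [ne_eq, Fin.reduceEq, not_false_eq_true, Function.update_of_ne, e9];
              rw [getD_middle _ _ _ hj]; exact hjA) ?_)
        simp only [ne_eq, Fin.reduceEq, not_false_eq_true, Function.update_of_ne, e9]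
        rw [getD_middle _ _ _ hj]
        refine exec_ite (t := 6) (fun hb => ?_) (fun hb => ?_)
        · have hlt : s.getD k 0 < s.getD j 0 := by simpa [Cond.holds] using hb
          refine (exec_cons (exec_copy (by simp [e4]; omega)
            (exec_add (by simp [e9, e1]; omega) ⟨rfl, ?_, j + 1, 0, ?_, ?_, hD.lt_step hj hlt,
              Or.inl ⟨?_, ?_⟩⟩))).weaken (by norm_num)
          · intro x _ _ _ _ _; simp [*]
          · simp [e4]
          · simp [e9, e1]; omega
          · simp [e12]
          · omega
        · have hle : ¬ s.getD k 0 < s.getD j 0 := by simpa [Cond.holds] using hb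
          refine exec_ite (t := 5) (fun hb => ?_) (fun hb => ?_)
          · have he : s.getD k 0 = s.getD j 0 := by simpa [Cond.holds] using hb
            refine (exec_cons (exec_add (by simp [e8, e1]; omega)
              (exec_add (by simp [e9, e1]; omega) ⟨rfl, ?_, j + 1, k + 1, ?_, ?_, hD.eq_step hj he,
                Or.inl ⟨?_, ?_⟩⟩))).weaken (by norm_num)
            · intro x _ _ _ _ _; simp [*]
            · simp [e8, e1]; omega
            · simp [e9, e1]; omega
            · simp [e12]
            · omega
          · have hne : ¬ s.getD k 0 = s.getD j 0 := by simpa [Cond.holds] using hb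
            refine (exec_copy (by simpa [e1] using h1w) ⟨rfl, ?_, j, k, ?_, ?_, hD,
                Or.inr ⟨?_, Or.inr ?_⟩⟩).weaken (by norm_num)
            · intro x _ _ _ _ _; simp [*]
            · simp [e8]
            · simp [e9]
            · simp [e1]
            · omega
      · have hj : ¬ j < s.length := by simpa [Cond.holds, e9, e3] using hb
        refine (exec_copy (by simpa [e1] using h1w) ⟨rfl, ?_, j, k, ?_, ?_, hD,
          Or.inr ⟨?_, Or.inl ?_⟩⟩).weaken (by norm_num)
        · intro x _ _ _ _ _; simp [*]
        · simp [e8]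
        · simp [e9]
        · simp [e1]
        · omega
    · have e2 : g' 2 = 0 := by rw [hf] <;> simp [h2]
      exact Or.inl ⟨by simp [Cond.holds, e12, e2], rfl, hf, j, k, e8, e9, hD, hend⟩
  · refine ⟨rfl, ?_, 1, 0, ?_, ?_, duvalInv_start hs, Or.inl ⟨?_, by omega⟩⟩
    · intro x _ _ _ _ _; simp [*]
    · simp [h4]
    · simp [h4, h1]
    · simp [h2]

/-! ### The backward step and the move of a character -/

/-- One step of the count for the backward step. -/
def countBody : Prog 16 :=
  .seq (.load 10 13) (.seq
    (.ite (.lt 10 14) (.add 7 7 1)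
      (.ite (.eq 10 14) (.ite (.le 13 6) (.add 7 7 1) .skip) .skip))
    (.add 13 13 1))

/-- The backward step: register `7` becomes `LF` of the position after index `6`. -/
def backwardStep : Prog 16 :=
  .seq (.load 14 6) (.seq (.copy 13 2) (.seq (.copy 7 2) (.loop (.lt 13 4) countBody)))

/-- One step of the shift to the right. -/
def moveBody : Prog 16 :=
  .seq (.sub 11 13 1) (.seq (.load 10 11) (.seq (.store 13 10) (.copy 13 11)))

/-- Move the character at index `13` to the left to index `7`. -/
def moveChar : Prog 16 :=
  .seq (.load 14 13) (.seq (.loop (.lt 7 13) moveBody) (.store 7 14))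

/-- The part of `LF` that is due to the first `i` characters. -/
def partialLF (B : List ℕ) (c p i : ℕ) : ℕ :=
  (B.take i).countP (fun d => decide (d < c)) + (B.take (min i (p + 1))).count c

/-- A position adds at most one, since being smaller than `c` and being equal to `c` exclude each
other. A single pass can thus compute both summands of LF in one register. -/
theorem partialLF_succ (B : List ℕ) (c p : ℕ) {i : ℕ} (hi : i < B.length) :
    partialLF B c p (i + 1) = partialLF B c p i +
      if B.getD i 0 < c then 1 else if B.getD i 0 = c ∧ i ≤ p then 1 else 0 := by
  rw [partialLF, partialLF, List.take_succ_eq_append_getElem hi, List.countP_append,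
    List.getD_eq_getElem _ _ hi]
  rcases le_or_gt i p with h | h
  · rw [min_eq_left (by omega), min_eq_left (by omega), List.take_succ_eq_append_getElem hi,
      List.count_append]
    by_cases h1 : B[i] < c
    · have : B[i] ≠ c := by omega
      simp [h1, this]; omega
    · by_cases h2 : B[i] = c
      · simp [h2, h]; omega
      · simp [h1, h2]
  · rw [min_eq_right (by omega), min_eq_right (by omega)]
    have : ¬ i ≤ p := by omega
    by_cases h1 : B[i] < c
    · simp [h1]; omega
    · simp [h1, this]

theorem partialLF_zero (B : List ℕ) (c p : ℕ) : partialLF B c p 0 = 0 := by simp [partialLF]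

theorem partialLF_le (B : List ℕ) (c p : ℕ) {i : ℕ} (hi : i ≤ B.length) :
    partialLF B c p i ≤ i := by
  induction i with
  | zero => simp [partialLF]
  | succ i ih =>
    rw [partialLF_succ _ _ _ hi]
    have := ih (by omega)
    split_ifs <;> omega

theorem partialLF_length (B : List ℕ) {p : ℕ} (hp : p < B.length) :
    partialLF B (B.getD p 0) p B.length = LF B (p + 1) := by
  rw [partialLF, LF, countSmaller, rank, charAt, List.take_length, min_eq_right (by omega),
    Nat.add_sub_cancel]

theorem exec_backwardStep {w σ : ℕ} {g : Fin 17 → ℕ} {B Z : List ℕ}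
    (h1 : g 1 = 1) (h2 : g 2 = 0) (h4 : g 4 = B.length) (h6 : g 6 < B.length)
    (hA : ∀ c ∈ B ++ Z, c < 2 ^ w) (hw : B.length + 1 < 2 ^ w) :
    Exec w σ backwardStep (12 * B.length + 10) g (B ++ Z) (fun g' A' => A' = B ++ Z ∧
      (∀ x, x ≠ 7 → x ≠ 10 → x ≠ 13 → x ≠ 14 → g' x = g x) ∧ g' 7 = LF B (g 6 + 1)) := by
  have hget : ∀ i, i < B.length → (B ++ Z).getD i 0 = B.getD i 0 := fun i hi =>
    getD_append_left _ _ hi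
  have hlt : ∀ i, i < B.length → B.getD i 0 < 2 ^ w := fun i hi => by
    rw [← hget i hi]
    exact getD_lt_of_forall hA (by simp; omega)
  refine Exec.weaken (t := B.length * (11 + 1) + 1 + 6) ?_ (by omega)
  unfold backwardStep
  refine exec_cons (exec_load (by simp; omega) (by rw [hget _ h6]; exact hlt _ h6) ?_)
  rw [hget _ h6]
  refine exec_cons (exec_copy (by simp [h2]) ?_)
  refine exec_cons (exec_copy (by simp [h2]) ?_)
  refine exec_loop (fun m g' A' => A' = B ++ Z ∧
    (∀ x, x ≠ 7 → x ≠ 10 → x ≠ 13 → x ≠ 14 → g' x = g x) ∧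
    g' 14 = B.getD (g 6) 0 ∧ g' 13 + m = B.length ∧
    g' 7 = partialLF B (B.getD (g 6) 0) (g 6) (g' 13)) ?_ ?_
  · rintro m g' A' ⟨rfl, hf, e14, em, e7⟩
    have e1 : g' 1 = 1 := by rw [hf] <;> simp [h1]
    have e4 : g' 4 = B.length := by rw [hf] <;> simp [h4]
    have e6 : g' 6 = g 6 := by rw [hf] <;> simp
    rcases m with _ | m
    · refine Or.inl ⟨by simp [Cond.holds, e4]; omega, rfl, hf, ?_⟩
      rw [e7, show g' 13 = B.length by omega, partialLF_length _ h6]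
    · have hi : g' 13 < B.length := by omega
      refine Or.inr ⟨by simp [Cond.holds, e4]; omega, m, rfl, ?_⟩
      refine exec_cons (t := 9) (exec_load (by simp; omega)
        (by rw [hget _ hi]; exact hlt _ hi) ?_)
      rw [hget _ hi]
      have hle := partialLF_le B (B.getD (g 6) 0) (g 6) hi.le
      have hsucc := partialLF_succ B (B.getD (g 6) 0) (g 6) hi
      have mid : Exec w σ (.ite (.lt 10 14) (.add 7 7 1)
          (.ite (.eq 10 14) (.ite (.le 13 6) (.add 7 7 1) .skip) .skip) : Prog 16) 4
          (Function.update g' 10 (B.getD (g' 13) 0)) (B ++ Z) (fun g'' A'' => A'' = B ++ Z ∧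
            g'' = Function.update (Function.update g' 10 (B.getD (g' 13) 0)) 7
              (partialLF B (B.getD (g 6) 0) (g 6) (g' 13 + 1))) := by
        refine exec_ite (t := 3) (fun hb => ?_) (fun hb => ?_)
        · simp only [Cond.holds, Function.update_self, ne_eq, Fin.reduceEq, not_false_eq_true,
            Function.update_of_ne, e14, decide_eq_true_eq] at hb
          rw [if_pos hb] at hsucc
          refine (exec_add (by simp [-List.getD_eq_getElem?_getD, e7, e1]; omega) ⟨rfl, ?_⟩).weaken (by norm_num)
          simp [-List.getD_eq_getElem?_getD, e7, e1, hsucc]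
        · simp only [Cond.holds, Function.update_self, ne_eq, Fin.reduceEq, not_false_eq_true,
            Function.update_of_ne, e14, decide_eq_false_iff_not] at hb
          rw [if_neg hb] at hsucc
          refine exec_ite (t := 2) (fun hb => ?_) (fun hb => ?_)
          · simp only [Cond.holds, Function.update_self, ne_eq, Fin.reduceEq, not_false_eq_true,
              Function.update_of_ne, e14, decide_eq_true_eq] at hb
            refine exec_ite (t := 1) (fun hb' => ?_) (fun hb' => ?_)
            · simp only [Cond.holds, ne_eq, Fin.reduceEq, not_false_eq_true,
                Function.update_of_ne, e6, decide_eq_true_eq] at hb'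
              rw [if_pos ⟨hb, hb'⟩] at hsucc
              refine exec_add (by simp [-List.getD_eq_getElem?_getD, e7, e1]; omega) ⟨rfl, ?_⟩
              simp [-List.getD_eq_getElem?_getD, e7, e1, hsucc]
            · simp only [Cond.holds, ne_eq, Fin.reduceEq, not_false_eq_true,
                Function.update_of_ne, e6, decide_eq_false_iff_not] at hb'
              rw [if_neg (fun h => hb' h.2)] at hsucc
              refine exec_skip ⟨rfl, ?_⟩
              rw [hsucc, add_zero, ← e7, Function.update_comm (by decide), Function.update_eq_self]
          · simp only [Cond.holds, Function.update_self, ne_eq, Fin.reduceEq, not_false_eq_true,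
              Function.update_of_ne, e14, decide_eq_false_iff_not] at hb
            rw [if_neg (fun h => hb h.1)] at hsucc
            refine (exec_skip ⟨rfl, ?_⟩).weaken (by norm_num)
            rw [hsucc, add_zero, ← e7, Function.update_comm (by decide), Function.update_eq_self]
      refine (exec_seq (t' := 1) (mid.mono le_rfl ?_)).weaken (by norm_num)
      rintro g'' A'' ⟨rfl, rfl⟩
      refine exec_add (by simp [e1]; omega) ⟨rfl, ?_, ?_, ?_, ?_⟩
      · intro x _ _ _ _; simp [*]
      · simp [e14]
      · simp [e1]; omega
      · simp [e1]
  · refine ⟨rfl, ?_, ?_, ?_, ?_⟩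
    · intro x _ _ _ _; simp [*]
    · simp
    · simp [h2]
    · simp [h2, partialLF_zero]

theorem set_middle (P S : List ℕ) (d v : ℕ) : (P ++ d :: S).set P.length v = P ++ v :: S := by
  rw [List.set_append_right _ _ le_rfl]
  simp

theorem getD_middle_cons (P S : List ℕ) (d : ℕ) : (P ++ d :: S).getD P.length 0 = d := by
  rw [getD_append_right _ _ le_rfl]
  simp

theorem exec_moveChar {w σ : ℕ} {g : Fin 17 → ℕ} {X Y Z : List ℕ} {c : ℕ}
    (h1 : g 1 = 1) (h7 : g 7 = X.length) (h13 : g 13 = X.length + Y.length)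
    (hA : ∀ d ∈ X ++ Y ++ c :: Z, d < σ) (hσ : σ ≤ 2 ^ w)
    (hw : X.length + Y.length + 1 < 2 ^ w) :
    Exec w σ moveChar (8 * Y.length + 10) g (X ++ Y ++ c :: Z) (fun g' A' =>
      A' = X ++ c :: Y ++ Z ∧
      ∀ x, x ≠ 10 → x ≠ 11 → x ≠ 13 → x ≠ 14 → g' x = g x) := by
  refine Exec.weaken (t := 1 + (Y.length * (7 + 1) + 1) + 1 + 2) ?_ (by omega)
  have hc : c < σ := hA c (by simp)
  have hl : g 13 = (X ++ Y).length := by simp [h13]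
  unfold moveChar
  refine exec_cons (exec_load (by rw [hl]; simp)
    (by rw [hl, getD_middle_cons]; omega) ?_)
  rw [hl, getD_middle_cons]
  -- `Y₁` is still to be shifted and `Y₂` has been shifted. The entry `d` is the stale content of
  -- the free cell, while the moved character is kept in register 14.
  refine exec_seq (exec_loop (fun m g' A' => ∃ Y₁ d Y₂, A' = X ++ Y₁ ++ d :: Y₂ ++ Z ∧
    Y = Y₁ ++ Y₂ ∧ g' 13 = X.length + Y₁.length ∧ Y₁.length = m ∧ g' 14 = c ∧
    ∀ x, x ≠ 10 → x ≠ 11 → x ≠ 13 → x ≠ 14 → g' x = g x) ?_ ?_)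
  · rintro m g' A' ⟨Y₁, d, Y₂, rfl, rfl, e13, em, e14, hf⟩
    have e1 : g' 1 = 1 := by rw [hf] <;> simp [h1]
    have e7 : g' 7 = X.length := by rw [hf] <;> simp [h7]
    rcases List.eq_nil_or_concat Y₁ with rfl | ⟨Y₁, y, rfl⟩
    · refine Or.inl ⟨by simp [Cond.holds, e13, e7], ?_⟩
      refine exec_store (by simp [e7]) (by rw [e14]; exact hc) ⟨?_, hf⟩
      rw [e7, e14, List.append_nil, List.append_assoc, List.cons_append, set_middle]
      simp
    · have hy : y < σ := hA y (by simp)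
      simp only [List.concat_eq_append, List.length_append, List.length_cons, List.length_nil]
        at *
      refine Or.inr ⟨by simp [Cond.holds, e13, e7], Y₁.length, by omega, ?_⟩
      have a1 : X ++ (Y₁ ++ [y]) ++ d :: Y₂ ++ Z = (X ++ Y₁) ++ y :: (d :: Y₂ ++ Z) := by simp
      have a2 : (X ++ Y₁) ++ y :: (d :: Y₂ ++ Z) = (X ++ Y₁ ++ [y]) ++ d :: (Y₂ ++ Z) := by simp
      have l1 : g' 13 - g' 1 = (X ++ Y₁).length := by simp; omega
      have l2 : g' 13 = (X ++ Y₁ ++ [y]).length := by simp; omega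
      rw [a1]
      refine exec_cons (t := 5) (exec_sub (by omega) ?_)
      refine exec_cons (t := 3) (exec_load (by simp; omega)
        (by rw [Function.update_self, l1, getD_middle_cons]; omega) ?_)
      rw [Function.update_self, l1, getD_middle_cons]
      refine exec_cons (t := 1) (exec_store (by simp; omega) (by simpa using hy) ?_)
      refine exec_copy (by simp; omega) ⟨Y₁, y, y :: Y₂, ?_, ?_, ?_, rfl, ?_, ?_⟩
      · simp only [ne_eq, Fin.reduceEq, not_false_eq_true, Function.update_of_ne,
          Function.update_self]
        rw [a2, l2, set_middle]
        simp
      · simp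
      · simp
      · simpa using e14
      · intro x _ _ _ _; simp [*]
  · refine ⟨Y, c, [], by simp, by simp, by simp [h13], rfl, by simp, ?_⟩
    intro x _ _ _ _; simp [*]

/-! ### One insertion on the machine -/

/-- One insertion: find the next factor if the current one is used up, and make a backward step
otherwise; then move the next character to its place. -/
def insertBody : Prog 16 :=
  .seq (.ite (.eq 5 2) (.seq duval (.seq (.sub 5 9 8) (.copy 7 2))) backwardStep)
    (.seq (.add 13 4 5) (.seq (.sub 13 13 1) (.seq moveChar
      (.seq (.copy 6 7) (.seq (.sub 5 5 1) (.add 4 4 1))))))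

/-- The memory after `i` insertions of the algorithm for `L`, in front of the unused text `R`. -/
structure InsertMem (σ : ℕ) (L R : List ℕ) (n k i : ℕ) (g : Fin 17 → ℕ) (A : List ℕ) : Prop where
  text : A = insLayout L i ++ R
  char : ∀ c ∈ A, c < σ
  reg0 : g 0 = n
  reg1 : g 1 = 1
  reg2 : g 2 = 0
  reg3 : g 3 = L.length
  reg4 : g 4 = i
  reg5 : g 5 = (insState L i).cur.length
  reg6 : (insState L i).cur ≠ [] → g 6 + 1 = (insState L i).pos
  reg15 : g 15 = k

/-- The character to be inserted is known by its index `i + e - 1`, its new index is `q`. -/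
def InsertReady (L R : List ℕ) (i q e : ℕ) (A : List ℕ) : Prop :=
  ∃ X Y c Z, A = X ++ Y ++ c :: Z ∧ q = X.length ∧ i + e = X.length + Y.length + 1 ∧ 1 ≤ e ∧
    X ++ c :: Y ++ Z = insLayout L (i + 1) ++ R ∧ (insState L (i + 1)).cur.length + 1 = e ∧
    (insState L (i + 1)).pos = X.length + 1

theorem dropLast_append_getLastD {f : List ℕ} (hf : f ≠ []) :
    f.dropLast ++ [f.getLastD 0] = f := by
  rw [List.getLastD_eq_getLast?, List.getLast?_eq_some_getLast hf]
  exact List.dropLast_append_getLast hf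

theorem insertReady_factor {L R f : List ℕ} {G : List (List ℕ)} {i : ℕ}
    (hi : (insState L i).built.length = i) (hc : (insState L i).cur = [])
    (hr : (insState L i).rest = f :: G) (hf : f ≠ [])
    (hn : (insState L i).next = ⟨f.getLastD 0 :: (insState L i).built, 1, f.dropLast, G⟩) :
    InsertReady L R i 0 f.length (insLayout L i ++ R) := by
  have hf0 := List.length_pos_iff.2 hf
  refine ⟨[], (insState L i).built ++ f.dropLast, f.getLastD 0, G.flatten ++ R, ?_, rfl, ?_, hf0,
    ?_, ?_, ?_⟩
  · rw [insLayout, hc, hr]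
    conv_lhs => rw [List.flatten_cons, ← dropLast_append_getLastD hf]
    simp
  · simp [hi]; omega
  · rw [insLayout, insState_succ, hn]
    simp
  · rw [insState_succ, hn]
    simp; omega
  · rw [insState_succ, hn]
    rfl

theorem insertReady_backward {L R : List ℕ} {i q : ℕ}
    (hi : (insState L i).built.length = i) (hc : (insState L i).cur ≠ [])
    (hq : q ≤ (insState L i).built.length)
    (hn : (insState L i).next = ⟨(insState L i).built.insertIdx q ((insState L i).cur.getLastD 0),
      q + 1, (insState L i).cur.dropLast, (insState L i).rest⟩) :
    InsertReady L R i q (insState L i).cur.length (insLayout L i ++ R) := by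
  have hc0 := List.length_pos_iff.2 hc
  refine ⟨(insState L i).built.take q, (insState L i).built.drop q ++ (insState L i).cur.dropLast,
    (insState L i).cur.getLastD 0, (insState L i).rest.flatten ++ R, ?_, by simp [hq], ?_, hc0,
    ?_, ?_, ?_⟩
  · rw [insLayout]
    conv_lhs => rw [← dropLast_append_getLastD hc]
    simp only [List.append_assoc, List.cons_append, List.nil_append]
    rw [← List.append_assoc (List.take q _), List.take_append_drop]
  · simp; omega
  · rw [insLayout, insState_succ, hn, insertIdx_eq _ _ _ hq]
    simp
  · rw [insState_succ, hn]
    simp; omega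
  · rw [insState_succ, hn]
    simp [hq]

/-- Both branches establish `InsertReady`: Duval's scan yields the length of the next factor and
target index 0, the backward step yields the target index LF. The moving code afterwards is common.
-/
theorem exec_insertBody {w σ n k : ℕ} {L R : List ℕ} {i : ℕ} (hi : i < L.length)
    (hσ : σ ≤ 2 ^ w) (hw : L.length + 1 < 2 ^ w) {g : Fin 17 → ℕ} {A : List ℕ}
    (h : InsertMem σ L R n k i g A) :
    Exec w σ insertBody (100 * L.length) g A (InsertMem σ L R n k (i + 1)) := by
  obtain ⟨rfl, hA, r0, r1, r2, r3, r4, r5, r6, r15⟩ := h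
  obtain ⟨hinv, hlen, htot⟩ := insState_inv L hi.le
  obtain ⟨hflat, hL, hF⟩ := lyndonFactors_spec L
  have hA2 : ∀ c ∈ insLayout L i ++ R, c < 2 ^ w := fun c hc => (hA c hc).trans_le hσ
  have mid : Exec w σ (.ite (.eq 5 2) (.seq duval (.seq (.sub 5 9 8) (.copy 7 2))) backwardStep)
      (13 * L.length + 30) g (insLayout L i ++ R) (fun g' A' => A' = insLayout L i ++ R ∧
        g' 0 = n ∧ g' 1 = 1 ∧ g' 2 = 0 ∧ g' 3 = L.length ∧ g' 4 = i ∧ g' 15 = k ∧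
        InsertReady L R i (g' 7) (g' 5) (insLayout L i ++ R)) := by
    refine exec_ite (t := 13 * L.length + 29) (fun hb => ?_) (fun hb => ?_)
    · have hcur : (insState L i).cur = [] := by
        rw [← List.length_eq_zero_iff, ← r5, ← r2]
        simpa [Cond.holds] using hb
      have hdone : FactorsDone (lyndonFactors L) (insState L i) := by
        rcases hinv with h | ⟨j, hj, h⟩
        · exact h
        · exact absurd hcur (h.next hj hL).2.1
      rcases hr : (insState L i).rest with _ | ⟨f, G⟩
      · rw [hcur, hr] at htot
        simp at htot
        omega
      obtain ⟨hn, -⟩ := hdone.next hL hF hr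
      obtain ⟨done, -, -, hsplit, -⟩ := hdone
      rw [hr] at hsplit
      have hfL : IsLyndon f := hL f (by simp [hsplit])
      have hFr : (f :: G).Pairwise (fun f g => g ≤ f) := by
        rw [hsplit, List.pairwise_append] at hF
        exact hF.2.1
      have hs0 : (f :: G).flatten ≠ [] := by simp [hfL.1]
      have hready := insertReady_factor (R := R) hlen hcur hr hfL.1 hn
      have htext : insLayout L i ++ R = (insState L i).built ++ (f :: G).flatten ++ R := by
        rw [insLayout, hcur, hr, List.append_nil]
      rw [hcur, hr] at htot
      simp only [List.length_nil, add_zero] at htot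
      rw [htext] at hA2 hready ⊢
      refine (exec_seq (t' := 3) (exec_duval hs0 r1 r2 (by omega) (by omega) hA2 (by omega)
        |>.mono le_rfl ?_)).weaken (by omega)
      rintro g' A' ⟨rfl, hf, a, b, e8, e9, hD, hend⟩
      -- The scan sees only the remaining text; its final period is the length of the first
      -- remaining factor.
      have hper := hD.length_eq hend hfL hFr
      have hble := hD.le
      refine exec_cons (exec_sub (by omega) (exec_copy ?_ ?_))
      · simp [hf, r2]
      · have e5 : g' 9 - g' 8 = f.length := by omega
        refine ⟨rfl, ?_, ?_, ?_, ?_, ?_, ?_, ?_⟩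
        · simp [hf, r0]
        · simp [hf, r1]
        · simp [hf, r2]
        · simp [hf, r3]
        · simp [hf, r4]
        · simp [hf, r15]
        · simpa [e5, hf, r2] using hready
    · have hcur : (insState L i).cur ≠ [] := by
        rw [← List.length_pos_iff, ← r5, Nat.pos_iff_ne_zero, ← r2]
        simpa [Cond.holds] using hb
      obtain ⟨j, hj, hpart⟩ : ∃ j, 0 < j ∧ FactorPartial (lyndonFactors L) (insState L i) j := by
        rcases hinv with ⟨_, _, h, -⟩ | h
        · exact absurd h hcur
        · exact h
      obtain ⟨hn, -, hp1, hp2, hq, -⟩ := hpart.next hj hL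
      have hready := insertReady_backward (R := R) hlen hcur hq hn
      have hpos := r6 hcur
      have htext : insLayout L i ++ R = (insState L i).built ++
          ((insState L i).cur ++ ((insState L i).rest.flatten ++ R)) := by
        simp [insLayout]
      rw [htext] at hA2 hready ⊢
      refine (exec_backwardStep r1 r2 (by omega) (by omega) hA2 (by omega)).mono (by omega) ?_
      rintro g' A' ⟨rfl, hf, e7⟩
      refine ⟨rfl, ?_, ?_, ?_, ?_, ?_, ?_, ?_⟩
      · simp [hf, r0]
      · simp [hf, r1]
      · simp [hf, r2]
      · simp [hf, r3]
      · simp [hf, r4]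
      · simp [hf, r15]
      · rwa [e7, hpos, hf 5 (by decide) (by decide) (by decide) (by decide), r5]
  refine (exec_seq (t' := 8 * L.length + 25) (mid.mono le_rfl ?_)).weaken (by omega)
  rintro g' A' ⟨rfl, e0, e1, e2, e3, e4, e15, X, Y, c, Z, hsp, e7, e5, h5, hnew, hcur', hpos'⟩
  rw [hsp] at hA ⊢
  have hXY : X.length + Y.length + 1 ≤ L.length := by
    have hlen' := length_insLayout L (i := i + 1) hi
    obtain ⟨-, h1, h2⟩ := insState_inv L (i := i + 1) hi
    omega
  refine exec_cons (t := 8 * L.length + 23) (exec_add (by omega) ?_)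
  refine exec_cons (t := 8 * L.length + 21) (exec_sub (by simp; omega) ?_)
  refine (exec_seq (t' := 6) ((exec_moveChar (X := X) (Y := Y) (Z := Z) (c := c) (by simpa using e1)
    (by simpa using e7) (by simp [e1, e4]; omega) hA hσ (by omega)).mono le_rfl ?_)).weaken (by omega)
  rintro g'' A'' ⟨rfl, hf⟩
  have f0 : g'' 0 = n := by rw [hf] <;> simp [e0]
  have f1 : g'' 1 = 1 := by rw [hf] <;> simp [e1]
  have f2 : g'' 2 = 0 := by rw [hf] <;> simp [e2]
  have f3 : g'' 3 = L.length := by rw [hf] <;> simp [e3]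
  have f4 : g'' 4 = i := by rw [hf] <;> simp [e4]
  have f5 : g'' 5 = g' 5 := by rw [hf] <;> simp
  have f7 : g'' 7 = X.length := by rw [hf] <;> simp [e7]
  have f15 : g'' 15 = k := by rw [hf] <;> simp [e15]
  refine exec_cons (t := 4) (exec_copy (by omega) ?_)
  refine exec_cons (t := 2) (exec_sub (by simp [f5, f1]; omega) ?_)
  refine (exec_add (by simp [f4, f1]; omega) ?_).weaken (by norm_num)
  refine ⟨hnew, ?_, ?_, ?_, ?_, ?_, ?_, ?_, ?_, ?_⟩
  · intro d hd
    refine hA d ?_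
    simp only [List.append_assoc, List.cons_append, List.mem_append, List.mem_cons] at hd ⊢
    tauto
  · simp [f0]
  · simp [f1]
  · simp [f2]
  · simp [f3]
  · simp [f4, f1]
  · simp [f5, f1]; omega
  · intro _
    simp [f7, hpos']
  · simp [f15]

/-- The memory is ready for the insertion algorithm at the start. -/
theorem insertMem_zero {σ n k : ℕ} {L R : List ℕ} {g : Fin 17 → ℕ}
    (hA : ∀ c ∈ L ++ R, c < σ) (r0 : g 0 = n) (r1 : g 1 = 1) (r2 : g 2 = 0)
    (r3 : g 3 = L.length) (r4 : g 4 = 0) (r5 : g 5 = 0) (r15 : g 15 = k) :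
    InsertMem σ L R n k 0 g (L ++ R) :=
  ⟨by rw [insLayout_zero], hA, r0, r1, r2, r3, r4, by rw [r5]; rfl, fun h => absurd rfl h, r15⟩

/-! ### The bijective transform -/

/-- The program for the bijective transform. -/
def bbwtProg : Prog 16 :=
  .seq (.seq (.const 1 1) (.copy 3 0)) (.seq (.loop (.lt 4 3) insertBody) .skip)

theorem bbwtProg_spec {w σ : ℕ} {T : List ℕ} (hT : T ≠ []) (hA : ∀ c ∈ T, c < σ)
    (hσ : σ ≤ 2 ^ w) (hw : T.length + 1 < 2 ^ w) :
    PerformsInsertions w σ bbwtProg T T (120 * T.length) ∧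
    HaltsWith w σ bbwtProg T (120 * T.length ^ 2) (bbwt T) := by
  have hpos := List.length_pos_iff.2 hT
  have main : PerformsInsertions w σ bbwtProg T T (100 * T.length + 1) ∧
      HaltsWith w σ bbwtProg T (3 + T.length * (100 * T.length + 1) + 1 + 3) (bbwt T) := by
    refine performsInsertions_and_haltsWith (InsertMem σ T [] T.length 0) ?_ ?_ ?_ ?_
    · refine exec_cons (exec_const (by omega) (exec_copy (by simp; omega) ?_))
      have := insertMem_zero (σ := σ) (n := T.length) (k := 0) (L := T) (R := [])
        (g := Function.update (Function.update (fun x : Fin 17 => if x = 0 then T.length else 0)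
          1 1) 3 T.length)
        (by simpa using hA) (by simp) (by simp) (by simp) (by simp) (by simp) (by simp) (by simp)
      simpa using this
    · intro i hi g A h
      exact ⟨by simp [Cond.holds, h.reg3, h.reg4, hi], exec_insertBody hi hσ hw h⟩
    · intro g A h
      refine ⟨by simp [Cond.holds, h.reg3, h.reg4], exec_skip ?_⟩
      rw [h.text, insLayout_length, List.append_nil]
    · intro i _ g A h
      rw [h.text]
      exact List.prefix_append _ _
  obtain ⟨⟨τ, hτ, h⟩, s, hs, h'⟩ := main
  refine ⟨⟨τ, fun i hi => ⟨(hτ i hi).1, (hτ i hi).2.trans (by omega)⟩, h⟩, s, hs.trans ?_, h'⟩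
  nlinarith

/-! ### The programs for the cyclic transform -/

/-- Divide register `14` by register `5`, with the quotient in `15` and the remainder in `14`. -/
def divide : Prog 16 := .loop (.le 5 14) (.seq (.sub 14 14 5) (.add 15 15 1))

/-- Rotate the text to the right by one. -/
def rotateRight : Prog 16 := .seq (.copy 7 2) (.seq (.sub 13 3 1) moveChar)

/-- If the text is a power of a Lyndon word, set register `16`, and put the length of this word
into register `5` and the exponent into register `15`; otherwise rotate the text. -/
def searchBody : Prog 16 :=
  .seq duval (.ite (.eq 9 3)
    (.seq (.sub 5 9 8) (.seq (.copy 14 3) (.seq (.copy 15 2) (.seq divide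
      (.ite (.eq 14 2) (.copy 16 1) rotateRight)))))
    rotateRight)

/-- Write one character of the run expansion. -/
def expandBody : Prog 16 :=
  .seq (.ite (.eq 9 2) (.seq (.sub 4 4 1) (.seq (.load 10 4) (.copy 9 15))) .skip)
    (.seq (.sub 13 13 1) (.seq (.store 13 10) (.sub 9 9 1)))

/-- Expand each of the first characters to a run, from right to left. -/
def expand : Prog 16 :=
  .seq (.copy 13 0) (.seq (.copy 4 3) (.seq (.copy 9 2) (.loop (.ne 13 2) expandBody)))

/-- The program for the cyclic transform. -/
def bwtcProg : Prog 16 :=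
  .seq (.seq (.const 1 1) (.seq (.copy 3 0) (.seq (.loop (.eq 16 2) searchBody)
      (.seq (.copy 3 5) (.copy 5 2)))))
    (.seq (.loop (.lt 4 3) insertBody) expand)

theorem exec_divide {w σ : ℕ} {g : Fin 17 → ℕ} {A : List ℕ} (h1 : g 1 = 1) (h5 : 0 < g 5)
    (h15 : g 15 = 0) (hw : g 14 + 1 < 2 ^ w) :
    Exec w σ divide (4 * g 14 + 1) g A (fun g' A' => A' = A ∧
      (∀ x, x ≠ 14 → x ≠ 15 → g' x = g x) ∧ g' 14 = g 14 % g 5 ∧ g' 15 = g 14 / g 5) := by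
  have hdiv : g 14 / g 5 ≤ g 14 := Nat.div_le_self _ _
  refine Exec.weaken (t := (g 14 / g 5) * (3 + 1) + 1) ?_ (by omega)
  refine exec_loop (fun m g' A' => A' = A ∧ (∀ x, x ≠ 14 → x ≠ 15 → g' x = g x) ∧
    g' 14 % g 5 = g 14 % g 5 ∧ g' 15 + m = g 14 / g 5 ∧ m = g' 14 / g 5 ∧ g' 14 ≤ g 14) ?_ ?_
  · rintro m g' A' ⟨rfl, hf, e1, e2, e3, e4⟩
    have f1 : g' 1 = 1 := by rw [hf] <;> simp [h1]
    have f5 : g' 5 = g 5 := by rw [hf] <;> simp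
    rcases lt_or_ge (g' 14) (g 5) with h | h
    · rw [Nat.mod_eq_of_lt h] at e1
      rw [Nat.div_eq_of_lt h] at e3
      exact Or.inl ⟨by simp [Cond.holds, f5, h], rfl, hf, e1, by omega⟩
    · obtain ⟨d, hd⟩ := Nat.exists_eq_add_of_le' h
      rw [hd, Nat.add_mod_right] at e1
      rw [hd, Nat.add_div_right _ h5] at e3
      have hsub : g' 14 - g' 5 = d := by omega
      refine Or.inr ⟨by simp [Cond.holds, f5, h], d / g 5, e3, ?_⟩
      refine exec_cons (exec_sub (by omega) (exec_add (by simp [f1]; omega) ⟨rfl, ?_, ?_, ?_, ?_, ?_⟩))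
      · intro x _ _; simp [*]
      · simp [hsub, e1]
      · simp [f1]; omega
      · simp [hsub]
      · simp [hsub]; omega
  · exact ⟨rfl, fun _ _ _ => rfl, rfl, by omega, rfl, le_rfl⟩

/-! ### The search for the Lyndon conjugate -/

/-- For `v ≠ 0` the rotation `L.rotate v` has the infinite power of `L'`, so `L` is strictly below
`L'`. Rotating `L'` further by `L.length - v` gives the infinite power of `L`, so `L'` is at most
`L`. -/
theorem eq_zero_of_rotate_eq_strPow {L L' : List ℕ} {k k' v : ℕ} (hL : IsLyndon L)
    (hL' : IsLyndon L') (hk : 1 ≤ k) (hk' : 1 ≤ k') (hv : v < L.length)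
    (h : (strPow L k).rotate v = strPow L' k') : v = 0 := by
  by_contra h0
  have h1 := hL.key_lt_key_rotate (Nat.pos_of_ne_zero h0) hv
  have e : omegaPow (L.rotate v) = omegaPow L' := by
    rw [← omegaPow_strPow _ hk, ← rotate_strPow, h, omegaPow_strPow _ hk']
  have h2 := hL'.key_le_key_rotate (L.length - v)
  have e2 : key (L'.rotate (L.length - v)) = key L := by
    rw [key, key]
    congr 1
    funext i
    rw [omegaPow_rotate, ← e, omegaPow_rotate, show i + (L.length - v) + v = i + L.length by omega,
      omegaPow_add_length]
  rw [e2] at h2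
  have e3 : key (L.rotate v) = key L' := congrArg toLex e
  rw [e3] at h1
  exact (h1.trans_le h2).false

/-- At the goal the text is a power of `L` with factors `L, …, L`. The scan finds period `|L|` and
cannot stop early, since periodicity excludes a smaller character. Conversely, a scan that reaches
the end with a period dividing the length exhibits the text as a power of a Lyndon word, which
happens for no other `v < L.length`. -/
theorem search_test {L : List ℕ} {k v j i : ℕ} (hL : IsLyndon L) (hk : 1 ≤ k)
    (hv : v < L.length) (hD : DuvalInv ((strPow L k).rotate v) j i)
    (hend : j = ((strPow L k).rotate v).length ∨
      ((strPow L k).rotate v).getD j 0 < ((strPow L k).rotate v).getD i 0) :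
    (v = 0 ↔ j = k * L.length ∧ k * L.length % (j - i) = 0) ∧ (v = 0 → j - i = L.length) := by
  have hlen : ((strPow L k).rotate v).length = k * L.length := by
    rw [List.length_rotate, length_strPow]
  have hij := hD.lt
  have h0 : v = 0 → j - i = L.length := by
    rintro rfl
    obtain ⟨k, rfl⟩ := Nat.exists_eq_succ_of_ne_zero (show k ≠ 0 by omega)
    rw [List.rotate_zero, strPow, List.replicate_succ] at hD hend
    refine hD.length_eq hend hL ?_
    rw [← List.replicate_succ]
    exact List.pairwise_replicate.2 (Or.inr le_rfl)
  refine ⟨⟨fun hv0 => ?_, fun h => ?_⟩, h0⟩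
  · have hper := h0 hv0
    rw [hper]
    refine ⟨?_, Nat.mul_mod_left _ _⟩
    rcases hend with h | h
    · rw [h, hlen]
    · have hle := hD.le
      rw [hlen] at hle
      by_contra hne
      subst hv0
      rw [List.rotate_zero, getD_strPow _ _ (by omega), getD_strPow _ _ (by omega),
        show j = i + L.length by omega, omegaPow_add_length] at h
      exact h.false
  · obtain ⟨q, hq⟩ := Nat.dvd_of_mod_eq_zero h.2
    have hpos := hL.length_pos
    have hq1 : 1 ≤ q := by
      rcases Nat.eq_zero_or_pos q with rfl | hq1
      · rw [mul_zero] at hq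
        have := Nat.mul_pos hk hpos
        omega
      · exact hq1
    refine eq_zero_of_rotate_eq_strPow hL hD.lyndon hk hq1 hv ?_
    refine eq_strPow_of_period (by omega) hq1 (by rw [hlen, hq, mul_comm]) fun m hm => ?_
    exact hD.period m (by omega)

/-- The memory during the search, `v` rotations before the end. -/
structure SearchMem (L : List ℕ) (k v : ℕ) (g : Fin 17 → ℕ) (A : List ℕ) : Prop where
  text : A = (strPow L k).rotate v
  lt : v < L.length
  reg0 : g 0 = k * L.length
  reg1 : g 1 = 1
  reg2 : g 2 = 0
  reg3 : g 3 = k * L.length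
  reg4 : g 4 = 0
  reg16 : g 16 = 0

/-- The memory after the search. -/
structure FoundMem (L : List ℕ) (k : ℕ) (g : Fin 17 → ℕ) (A : List ℕ) : Prop where
  text : A = strPow L k
  reg0 : g 0 = k * L.length
  reg1 : g 1 = 1
  reg2 : g 2 = 0
  reg4 : g 4 = 0
  reg5 : g 5 = L.length
  reg15 : g 15 = k
  reg16 : g 16 = 1

theorem exec_rotateRight {w σ k v : ℕ} {L : List ℕ} {g : Fin 17 → ℕ} {A : List ℕ}
    (hA : ∀ c ∈ A, c < σ) (hσ : σ ≤ 2 ^ w) (hw : k * L.length + 1 < 2 ^ w) (hk : 1 ≤ k)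
    (h : SearchMem L k (v + 1) g A) :
    Exec w σ rotateRight (8 * (k * L.length) + 14) g A (SearchMem L k v) := by
  obtain ⟨rfl, h0, h1, h2, h3, h4, h5, h6⟩ := h
  have hpos : 0 < k * L.length := Nat.mul_pos hk (by omega)
  have hlen : ((strPow L k).rotate (v + 1)).length = k * L.length := by
    rw [List.length_rotate, length_strPow]
  have hne : (strPow L k).rotate (v + 1) ≠ [] := by
    rw [← List.length_pos_iff]; omega
  obtain ⟨Y, c, hYc⟩ : ∃ Y c, (strPow L k).rotate (v + 1) = [] ++ Y ++ [c] :=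
    ⟨_, _, (dropLast_append_getLastD hne).symm⟩
  have hrot : c :: Y = (strPow L k).rotate v := by
    -- Moving the last character to the front undoes one left rotation, so `v + 1` drops to `v`.
    refine List.rotate_injective 1 ?_
    simp only [List.rotate_rotate, hYc]
    simp
  rw [hYc] at hA hlen ⊢
  simp only [List.nil_append, List.length_append, List.length_cons, List.length_nil] at hlen
  refine Exec.weaken (t := 8 * Y.length + 10 + 2 + 2) ?_ (by omega)
  refine exec_cons (exec_copy (by omega) (exec_cons (exec_sub (by simp; omega) ?_)))
  refine (exec_moveChar (by simp [h2]) (by simp [h3]) (by simp [h2, h4]; omega) hA hσ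
    (by simp; omega)).mono le_rfl ?_
  rintro g' A' ⟨rfl, hf⟩
  refine ⟨by simpa using hrot, by omega, ?_, ?_, ?_, ?_, ?_, ?_⟩ <;> rw [hf] <;> simp [*]

theorem exec_searchBody {w σ k v : ℕ} {L : List ℕ} {g : Fin 17 → ℕ} {A : List ℕ}
    (hL : IsLyndon L) (hA : ∀ c ∈ A, c < σ) (hσ : σ ≤ 2 ^ w) (hw : k * L.length + 1 < 2 ^ w)
    (hk : 1 ≤ k) (h : SearchMem L k v g A) :
    Exec w σ searchBody (100 * (k * L.length)) g A (fun g' A' =>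
      (v = 0 ∧ FoundMem L k g' A') ∨ ∃ v', v = v' + 1 ∧ SearchMem L k v' g' A') := by
  have h' := h
  obtain ⟨rfl, hv, h0, h1, h2, h3, h4, h16⟩ := h'
  have hpos : 0 < k * L.length := Nat.mul_pos hk hL.length_pos
  have hlen : ((strPow L k).rotate v).length = k * L.length := by
    rw [List.length_rotate, length_strPow]
  have hne : (strPow L k).rotate v ≠ [] := by
    rw [← List.length_pos_iff]; omega
  have hduval := exec_duval (w := w) (σ := σ) (g := g) (X := []) (s := (strPow L k).rotate v)
    (Z := []) hne h1 h2 (by simpa using h4) (by rw [hlen]; simpa using h3)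
    (fun c hc => (hA c (by simpa using hc)).trans_le hσ) (by rw [hlen]; simpa using hw)
  rw [List.nil_append, List.append_nil, hlen] at hduval
  refine (exec_seq (t' := 12 * (k * L.length) + 30) (hduval.mono le_rfl ?_)).weaken (by omega)
  rintro g' A' ⟨rfl, hf, j, i, e8, e9, hD, hend⟩
  obtain ⟨htest, hper⟩ := search_test hL hk hv hD (by rw [hlen]; exact hend)
  simp only [List.length_nil, zero_add] at e8 e9
  have hij := hD.lt
  have hjn := hD.le
  rw [hlen] at hjn
  have f0 : g' 0 = k * L.length := by rw [hf] <;> simp [h0]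
  have f1 : g' 1 = 1 := by rw [hf] <;> simp [h1]
  have f2 : g' 2 = 0 := by rw [hf] <;> simp [h2]
  have f3 : g' 3 = k * L.length := by rw [hf] <;> simp [h3]
  have f4 : g' 4 = 0 := by rw [hf] <;> simp [h4]
  have f16 : g' 16 = 0 := by rw [hf] <;> simp [h16]
  refine exec_ite (t := 12 * (k * L.length) + 29) (fun hb => ?_) (fun hb => ?_)
  · have hj : j = k * L.length := by simpa [Cond.holds, e9, f3] using hb
    have hsub : g' 9 - g' 8 = j - i := by omega
    refine exec_cons (t := 12 * (k * L.length) + 27) (exec_sub (by omega) ?_)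
    refine exec_cons (t := 12 * (k * L.length) + 25) (exec_copy (by simp [f3]; omega) ?_)
    refine exec_cons (t := 12 * (k * L.length) + 23) (exec_copy (by simp [f2]) ?_)
    simp only [ne_eq, Fin.reduceEq, not_false_eq_true, Function.update_of_ne, f2, f3, hsub]
    have hdivide := exec_divide (w := w) (σ := σ) (A := (strPow L k).rotate v)
      (g := Function.update (Function.update (Function.update g' 5 (j - i)) 14 (k * L.length)) 15 0)
      (by simp [f1]) (by simp; omega) (by simp) (by simpa using hw)
    simp only [ne_eq, Fin.reduceEq, not_false_eq_true, Function.update_of_ne,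
      Function.update_self] at hdivide
    refine (exec_seq (t' := 8 * (k * L.length) + 15) (hdivide.mono le_rfl ?_)).weaken (by omega)
    rintro g'' A'' ⟨rfl, hf', e14, e15⟩
    have q0 : g'' 0 = k * L.length := by rw [hf'] <;> simp [f0]
    have q1 : g'' 1 = 1 := by rw [hf'] <;> simp [f1]
    have q2 : g'' 2 = 0 := by rw [hf'] <;> simp [f2]
    have q3 : g'' 3 = k * L.length := by rw [hf'] <;> simp [f3]
    have q4 : g'' 4 = 0 := by rw [hf'] <;> simp [f4]
    have q5 : g'' 5 = j - i := by rw [hf'] <;> simp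
    have q16 : g'' 16 = 0 := by rw [hf'] <;> simp [f16]
    refine exec_ite (t := 8 * (k * L.length) + 14) (fun hb => ?_) (fun hb => ?_)
    · have hm : k * L.length % (j - i) = 0 := by simpa [Cond.holds, e14, q2] using hb
      have hv0 := htest.2 ⟨hj, hm⟩
      refine (exec_copy (by omega) (Or.inl ⟨hv0, ?_⟩)).weaken (by omega)
      rw [hper hv0] at e15 q5
      rw [Nat.mul_div_cancel _ hL.length_pos] at e15
      refine ⟨by rw [hv0, List.rotate_zero], ?_, ?_, ?_, ?_, ?_, ?_, ?_⟩ <;>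
        simp [q0, q1, q2, q4, q5, e15]
    · have hm : ¬ k * L.length % (j - i) = 0 := by simpa [Cond.holds, e14, q2] using hb
      have hv0 : v ≠ 0 := fun h => hm (htest.1 h).2
      obtain ⟨v, rfl⟩ := Nat.exists_eq_succ_of_ne_zero hv0
      refine (exec_rotateRight hA hσ hw hk ⟨rfl, hv, q0, q1, q2, q3, q4, q16⟩).mono le_rfl
        fun g A h => Or.inr ⟨v, rfl, h⟩
  · have hj : ¬ j = k * L.length := by simpa [Cond.holds, e9, f3] using hb
    have hv0 : v ≠ 0 := fun h => hj (htest.1 h).1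
    obtain ⟨v, rfl⟩ := Nat.exists_eq_succ_of_ne_zero hv0
    refine (exec_rotateRight hA hσ hw hk ⟨rfl, hv, f0, f1, f2, f3, f4, f16⟩).mono (by omega)
      fun g A h => Or.inr ⟨v, rfl, h⟩

theorem exec_search {w σ k v : ℕ} {L : List ℕ} {g : Fin 17 → ℕ} {A : List ℕ}
    (hL : IsLyndon L) (hA : ∀ c ∈ A, c < σ) (hσ : σ ≤ 2 ^ w) (hw : k * L.length + 1 < 2 ^ w)
    (hk : 1 ≤ k) (h : SearchMem L k v g A) :
    Exec w σ (.loop (.eq 16 2) searchBody) ((v + 1) * (100 * (k * L.length) + 1) + 1) g A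
      (FoundMem L k) := by
  -- The measure is `v + 1`: there are `v` rotations and one final successful test.
  refine exec_loop (fun m g A => (∃ v, m = v + 1 ∧ SearchMem L k v g A) ∨ FoundMem L k g A) ?_
    (Or.inl ⟨v, rfl, h⟩)
  have hchar : ∀ v, ∀ c ∈ (strPow L k).rotate v, c < σ := fun v' c hc =>
    hA c (by rw [h.text]; simpa using hc)
  rintro m g A (⟨v, rfl, h⟩ | h)
  · refine Or.inr ⟨by simp [Cond.holds, h.reg16, h.reg2], v, rfl, ?_⟩
    refine (exec_searchBody hL (h.text ▸ hchar v) hσ hw hk h).mono le_rfl ?_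
    rintro g' A' (⟨-, h⟩ | h)
    · exact Or.inr h
    · exact Or.inl h
  · exact Or.inl ⟨by simp [Cond.holds, h.reg16, h.reg2], h⟩

/-! ### Run expansion -/

theorem length_expandRuns (k : ℕ) (B : List ℕ) : (expandRuns k B).length = B.length * k := by
  simp [expandRuns]

theorem getD_expandRuns {k : ℕ} (hk : 0 < k) (B : List ℕ) {u : ℕ} (hu : u < B.length * k) :
    (expandRuns k B).getD u 0 = B.getD (u / k) 0 := by
  induction B generalizing u with
  | nil => simp at hu
  | cons c B ih =>
    have e : expandRuns k (c :: B) = List.replicate k c ++ expandRuns k B := rfl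
    rw [e]
    rcases lt_or_ge u k with h | h
    · rw [getD_append_left _ _ (by simpa using h), List.getD_eq_getElem _ _ (by simpa using h),
        Nat.div_eq_of_lt h]
      simp
    · obtain ⟨u, rfl⟩ := Nat.exists_eq_add_of_le' h
      rw [List.length_cons, Nat.succ_mul] at hu
      rw [getD_append_right _ _ (by simp), List.length_replicate, Nat.add_sub_cancel,
        ih (by omega), Nat.add_div_right _ hk]
      rfl

theorem getD_set (A : List ℕ) {i : ℕ} (j v : ℕ) (hi : i < A.length) :
    (A.set i v).getD j 0 = if j = i then v else A.getD j 0 := by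
  rw [List.getD_eq_getElem?_getD, List.getElem?_set]
  by_cases h : i = j
  · subst h; simp [hi]
  · simp [h, Ne.symm h]

/-- The write position satisfies `m = g' 4 * k + g' 9`. Whenever a cell is written it is at or right
of the source index `g' 4`, whose character is already held in register 10. Hence the unread part of
`B` survives, and the content of `Z` never matters. -/
theorem exec_expand {w σ k : ℕ} {B Z : List ℕ} {g : Fin 17 → ℕ} (hk : 0 < k)
    (hB : ∀ c ∈ B ++ Z, c < σ) (hσ : σ ≤ 2 ^ w) (hlen : (B ++ Z).length = B.length * k)
    (hw : B.length * k + 1 < 2 ^ w) (h0 : g 0 = B.length * k) (h1 : g 1 = 1) (h2 : g 2 = 0)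
    (h3 : g 3 = B.length) (h15 : g 15 = k) :
    Exec w σ expand (15 * (B.length * k) + 10) g (B ++ Z) (fun _ A' => A' = expandRuns k B) := by
  have hbound : B.length ≤ B.length * k := Nat.le_mul_of_pos_right _ hk
  have hchar : ∀ i, i < B.length → B.getD i 0 < σ := fun i hi =>
    getD_lt_of_forall (fun c hc => hB c (by simp [hc])) hi
  -- For empty `B` the bound on the text says nothing about `k`, but then the loop body is never
  -- entered.
  have hkw : k < 2 ^ w ∨ B.length = 0 := by
    rcases Nat.eq_zero_or_pos B.length with h | h
    · exact Or.inr h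
    · have : k ≤ B.length * k := Nat.le_mul_of_pos_left _ h
      omega
  refine Exec.weaken (t := B.length * k * (14 + 1) + 1 + 6) ?_ (by omega)
  unfold expand
  refine exec_cons (exec_copy (by omega) ?_)
  refine exec_cons (exec_copy (by simp; omega) ?_)
  refine exec_cons (exec_copy (by simp [h2]) ?_)
  refine exec_loop (fun m g' A' => A'.length = B.length * k ∧ g' 1 = 1 ∧ g' 2 = 0 ∧ g' 15 = k ∧
    g' 13 = m ∧ m ≤ B.length * k ∧ m = g' 4 * k + g' 9 ∧ g' 9 ≤ k ∧
    (0 < g' 9 → g' 10 = B.getD (g' 4) 0) ∧ (∀ u < g' 4, A'.getD u 0 = B.getD u 0) ∧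
    ∀ u, m ≤ u → u < B.length * k → A'.getD u 0 = (expandRuns k B).getD u 0) ?_ ?_
  · rintro m g' A' ⟨hl, e1, e2, e15, e13, hm, hmeq, h9, h10, hpre, hsuf⟩
    rcases m with _ | m
    · refine Or.inl ⟨by simp [Cond.holds, e13, e2], ?_⟩
      exact ext_getD (by rw [hl, length_expandRuns]) fun u hu => hsuf u (by omega) (by omega)
    · refine Or.inr ⟨by simp [Cond.holds, e13, e2], m, rfl, ?_⟩
      have hBpos : B.length ≠ 0 := by
        intro h
        rw [h, zero_mul] at hm
        omega
      have mid : Exec w σ (.ite (.eq 9 2) (.seq (.sub 4 4 1) (.seq (.load 10 4) (.copy 9 15)))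
          .skip : Prog 16) 6 g' A' (fun g'' A'' => A'' = A' ∧ g'' 1 = 1 ∧ g'' 2 = 0 ∧ g'' 15 = k ∧
            g'' 13 = m + 1 ∧ m + 1 = g'' 4 * k + g'' 9 ∧ g'' 9 ≤ k ∧ 0 < g'' 9 ∧
            g'' 10 = B.getD (g'' 4) 0 ∧ g'' 4 ≤ g' 4) := by
        refine exec_ite (t := 5) (fun hb => ?_) (fun hb => ?_)
        · have h90 : g' 9 = 0 := by simpa [Cond.holds, e2] using hb
          obtain ⟨i, hi⟩ : ∃ i, g' 4 = i + 1 := by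
            refine Nat.exists_eq_succ_of_ne_zero fun h => ?_
            rw [h, zero_mul] at hmeq
            omega
          have hiB : i < B.length := by
            have : (i + 1) * k ≤ B.length * k := by rw [← hi]; omega
            exact Nat.le_of_mul_le_mul_right this hk
          have hAi : A'.getD i 0 = B.getD i 0 := hpre i (by omega)
          have hsub : g' 4 - g' 1 = i := by omega
          have := hchar i hiB
          refine exec_cons (t := 3) (exec_sub (by omega) ?_)
          refine exec_cons (t := 1) (exec_load (by rw [Function.update_self]; omega)
            (by rw [Function.update_self, hsub, hAi]; omega) ?_)
          rw [Function.update_self, hsub, hAi]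
          refine exec_copy (by simp [e15]; omega) ⟨rfl, ?_, ?_, ?_, ?_, ?_, ?_, ?_, ?_, ?_⟩
          · simp [e1]
          · simp [e2]
          · simp [e15]
          · simp [e13]
          · simp only [ne_eq, Fin.reduceEq, not_false_eq_true, Function.update_of_ne,
              Function.update_self, e15]
            rw [hmeq, hi, Nat.succ_mul, h90]
            rfl
          · simp [e15]
          · simpa [e15] using hk
          · simp
          · simp; omega
        · have h90 : ¬ g' 9 = 0 := by simpa [Cond.holds, e2] using hb
          exact (exec_skip ⟨rfl, e1, e2, e15, e13, hmeq, h9, by omega, h10 (by omega),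
            le_rfl⟩).weaken (by norm_num)
      refine (exec_seq (t' := 5) (mid.mono le_rfl ?_)).weaken (by norm_num)
      rintro g'' A'' ⟨rfl, q1, q2, q15, q13, qm, q9, q9', q10, q4⟩
      have hi : g'' 4 < B.length := by
        have : g'' 4 * k < B.length * k := by omega
        exact Nat.lt_of_mul_lt_mul_right this
      have hik : g'' 4 ≤ g'' 4 * k := Nat.le_mul_of_pos_right _ hk
      have hmA : m < A''.length := by omega
      have hsub : g'' 13 - g'' 1 = m := by omega
      have := hchar _ hi
      refine exec_cons (t := 3) (exec_sub (by omega) ?_)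
      rw [hsub]
      refine exec_cons (t := 1) (exec_store (by simpa using hmA)
        (by simp only [ne_eq, Fin.reduceEq, not_false_eq_true, Function.update_of_ne, q10]; omega) ?_)
      simp only [ne_eq, Fin.reduceEq, not_false_eq_true, Function.update_of_ne,
        Function.update_self, q10]
      refine exec_sub (by simp; omega) ⟨?_, ?_, ?_, ?_, ?_, ?_, ?_, ?_, ?_, ?_, ?_⟩
      · simpa using hl
      · simp [q1]
      · simp [q2]
      · simp [q15]
      · simp
      · omega
      · simp [q1]; omega
      · simp [q1]; omega
      · intro _
        simp only [ne_eq, Fin.reduceEq, not_false_eq_true, Function.update_of_ne, q10]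
      · intro u hu
        simp only [ne_eq, Fin.reduceEq, not_false_eq_true, Function.update_of_ne] at hu
        rw [getD_set _ _ _ hmA, if_neg (by omega)]
        exact hpre u (by omega)
      · intro u hu hu'
        rw [getD_set _ _ _ hmA]
        split_ifs with hum
        · subst hum
          rw [getD_expandRuns hk _ hu']
          congr 1
          symm
          rw [Nat.div_eq_iff hk]
          constructor <;> omega
        · exact hsuf u (by omega) hu'
  · refine ⟨hlen, ?_, ?_, ?_, ?_, le_rfl, ?_, ?_, ?_, ?_, ?_⟩
    · simp [h1]
    · simp [h2]
    · simp [h15]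
    · simp [h0]
    · simp [h3, h2]
    · simp [h2]
    · simp [h2]
    · intro u hu
      have hu' : u < B.length := by simpa [h3] using hu
      exact getD_append_left _ _ hu'
    · intro u hu hu'
      omega

/-! ### The cyclic transform -/

/-- The search leaves the text L^k, that is, `L` followed by a rest that the insertions ignore. They
produce the bijective transform of `L`, and expanding its runs gives the cyclic transform of the
text. -/
theorem bwtcProg_spec {w σ k j : ℕ} {P : List ℕ} (hk : 1 ≤ k)
    (hL : IsLyndon (P.rotate j)) (hA : ∀ c ∈ strPow P k, c < σ) (hσ : σ ≤ 2 ^ w)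
    (hw : (strPow P k).length + 1 < 2 ^ w) :
    PerformsInsertions w σ bwtcProg (strPow P k) (P.rotate j) (300 * (strPow P k).length) ∧
    HaltsWith w σ bwtcProg (strPow P k) (300 * (strPow P k).length ^ 2) (bwtc (strPow P k)) := by
  have hout : bwtc (strPow P k) = expandRuns k (bbwt (P.rotate j)) := by
    rw [bwtc_strPow _ hk, ← bwtc_rotate P j, hL.bwtc_eq_bbwt]
  rw [hout]
  -- `v` is the number of right rotations that lead from the input to the power of the Lyndon
  -- conjugate.
  obtain ⟨v, hv, hT⟩ : ∃ v < (P.rotate j).length,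
      strPow P k = (strPow (P.rotate j) k).rotate v := by
    have hpos := hL.length_pos
    rw [List.length_rotate] at hpos
    refine ⟨(P.length - j % P.length) % P.length, by simpa using Nat.mod_lt _ hpos, ?_⟩
    rw [rotate_strPow]
    congr 1
    conv_rhs => rw [← List.length_rotate P j, List.rotate_mod, List.length_rotate]
    rw [← List.rotate_mod P j, List.rotate_rotate,
      Nat.add_sub_cancel' (Nat.mod_lt _ hpos).le, List.rotate_length]
  generalize P.rotate j = L at *
  have hlen : (strPow P k).length = k * L.length := by
    rw [hT, List.length_rotate, length_strPow]
  have hLn : L.length ≤ k * L.length := Nat.le_mul_of_pos_left _ hk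
  have hpos := hL.length_pos
  have hchar : ∀ c ∈ strPow L k, c < σ := fun c hc => hA c (by rw [hT]; simpa using hc)
  obtain ⟨k', rfl⟩ : ∃ k', k = k' + 1 := ⟨k - 1, by omega⟩
  have main : PerformsInsertions w σ bwtcProg (strPow P (k' + 1)) L (100 * L.length + 1) ∧
      HaltsWith w σ bwtcProg (strPow P (k' + 1))
        (((v + 1) * (100 * ((k' + 1) * L.length) + 1) + 1 + 10) + L.length * (100 * L.length + 1) +
          (15 * ((k' + 1) * L.length) + 10) + 3) (expandRuns (k' + 1) (bbwt L)) := by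
    refine performsInsertions_and_haltsWith
      (InsertMem σ L (strPow L k') ((k' + 1) * L.length) (k' + 1)) ?_ ?_ ?_ ?_
    · refine Exec.weaken (t := 3 + ((v + 1) * (100 * ((k' + 1) * L.length) + 1) + 1) + 1 + 2 + 2)
        ?_ (by omega)
      refine exec_cons (exec_const (by omega) (exec_cons (exec_copy (by simp; omega) ?_)))
      refine exec_seq ((exec_search (v := v) hL hA hσ (by omega) (by omega) ⟨hT, hv, ?_, ?_, ?_, ?_,
        ?_, ?_⟩).mono le_rfl ?_)
      · simp [hlen]
      · simp
      · simp
      · simp [hlen]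
      · simp
      · simp
      · intro g A h
        refine exec_cons (t := 1) (exec_copy (by rw [h.reg5]; omega) (exec_copy (by simp [h.reg2]) ?_))
        rw [h.text, strPow_succ]
        refine insertMem_zero (by rw [← strPow_succ]; exact hchar) ?_ ?_ ?_ ?_ ?_ ?_ ?_
        · simp [h.reg0]
        · simp [h.reg1]
        · simp [h.reg2]
        · simp [h.reg5]
        · simp [h.reg4]
        · simp [h.reg2]
        · simp [h.reg15]
    · intro i hi g A h
      exact ⟨by simp [Cond.holds, h.reg3, h.reg4, hi], exec_insertBody hi hσ (by omega) h⟩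
    · intro g A h
      refine ⟨by simp [Cond.holds, h.reg3, h.reg4], ?_⟩
      have hB : (bbwt L).length = L.length := by
        rw [← insLayout_length, length_insLayout L le_rfl]
      obtain ⟨rfl, hA', r0, r1, r2, r3, -, -, -, r15⟩ := h
      rw [insLayout_length] at *
      have := exec_expand (B := bbwt L) (Z := strPow L k') (g := g) (k := k' + 1) (by omega) hA' hσ
        (by rw [List.length_append, length_strPow, hB]; ring) (by rw [hB, mul_comm]; omega)
        (by rw [r0, hB, mul_comm]) r1 r2 (by rw [r3, hB]) r15
      rwa [hB, mul_comm L.length] at this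
    · intro i _ g A h
      rw [h.text]
      exact List.prefix_append _ _
  rw [hlen]
  obtain ⟨⟨τ, hτ, h⟩, s, hs, h'⟩ := main
  refine ⟨⟨τ, fun i hi => ⟨(hτ i hi).1, (hτ i hi).2.trans (by omega)⟩, h⟩, s, hs.trans ?_, h'⟩
  generalize (k' + 1) * L.length = n at *
  -- Search and insertions each cost at most `n * (100 * n + 1)` up to lower-order terms, as `v + 1
  -- ≤ L.length ≤ n`.
  have a1 : (v + 1) * (100 * n + 1) ≤ n * (100 * n + 1) := Nat.mul_le_mul_right _ (by omega)
  have a2 : L.length * (100 * L.length + 1) ≤ n * (100 * n + 1) :=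
    Nat.mul_le_mul (by omega) (by omega)
  nlinarith

/-- The word holds all numbers below `(n + 1) ^ (a + 2)`. The exponent `a` covers the alphabet, and
the additional 2 makes `n + 1` fit strictly even for `a = 0`. -/
theorem lt_two_pow_wordBits {n : ℕ} (hn : 0 < n) (a : ℕ) :
    n + 1 < 2 ^ wordBits (a + 2) n ∧ (n + 1) ^ a ≤ 2 ^ wordBits (a + 2) n := by
  have h1 : n + 1 ≤ 2 ^ (Nat.log 2 n + 1) := Nat.lt_pow_succ_log_self (by norm_num) n
  have h2 : (n + 1) ^ (a + 2) ≤ 2 ^ wordBits (a + 2) n := by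
    rw [wordBits, mul_comm, pow_mul]
    exact Nat.pow_le_pow_left h1 _
  have h3 : n + 1 < (n + 1) ^ (a + 2) := by
    conv_lhs => rw [← pow_one (n + 1)]
    exact Nat.pow_lt_pow_right (by omega) (by omega)
  exact ⟨h3.trans_le h2, (Nat.pow_le_pow_right (by omega) (by omega)).trans h2⟩

end BWTInPlace

open BWTInPlace

theorem mainTheorem4 :
    -- the Lyndon factorization is well defined
    (∀ T : List ℕ, T ≠ [] → ∃! F, IsLyndonFactorization T F) ∧
    -- the insertion algorithm computes the bijective BWT
    (∀ T : List ℕ, T ≠ [] → (insState T T.length).built = bbwt T) ∧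
    -- it works in-place in quadratic time, with linear time for each backward step and insertion
    (∃ (r : ℕ) (p : Prog r) (D : ℕ), ∀ a : ℕ, ∃ C : ℕ, ∀ (σ : ℕ) (T : List ℕ), IsInput a σ T →
      PerformsInsertions (wordBits C T.length) σ p T T (D * T.length) ∧
      HaltsWith (wordBits C T.length) σ p T (D * T.length ^ 2) (bbwt T)) ∧
    -- both transforms of a Lyndon word coincide
    (∀ T : List ℕ, IsLyndon T → bwtc T = bbwt T) ∧
    -- a primitive string has a unique Lyndon conjugate, whose bijective BWT is the cyclic BWT
    (∀ P : List ℕ, P ≠ [] → IsPrimitive P →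
      (∃! j, j < P.length ∧ IsLyndon (P.rotate j)) ∧
      ∀ j, IsLyndon (P.rotate j) → bwtc P = bbwt (P.rotate j)) ∧
    -- every string is a power of a primitive string, and the cyclic BWT of a power is the
    -- run expansion
    (∀ T : List ℕ, T ≠ [] →
      ∃ P k, P ≠ [] ∧ IsPrimitive P ∧ 1 ≤ k ∧ T = strPow P k) ∧
    (∀ (P : List ℕ) (k : ℕ), P ≠ [] → IsPrimitive P → 1 ≤ k →
      bwtc (strPow P k) = expandRuns k (bwtc P)) ∧
    -- the cyclic BWT is constructed in this way, in-place in quadratic time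
    (∃ (r : ℕ) (p : Prog r) (D : ℕ), ∀ a : ℕ, ∃ C : ℕ, ∀ (σ : ℕ) (T : List ℕ), IsInput a σ T →
      HaltsWith (wordBits C T.length) σ p T (D * T.length ^ 2) (bwtc T) ∧
      ∀ (P : List ℕ) (k j : ℕ), P ≠ [] → IsPrimitive P → 1 ≤ k → T = strPow P k →
        IsLyndon (P.rotate j) →
        PerformsInsertions (wordBits C T.length) σ p T (P.rotate j) (D * T.length)) := by

  refine ⟨fun T _ => ⟨lyndonFactors T, lyndonFactors_spec T, fun F hF => (lyndonFactors_eq hF).symm⟩,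
    fun T _ => insState_built T, ⟨16, bbwtProg, 120, fun a => ⟨a + 2, ?_⟩⟩,
    fun T hT => hT.bwtc_eq_bbwt, fun P hP0 hP => ⟨existsUnique_lyndon_rotate hP0 hP, fun j hj => ?_⟩,
    fun T hT => exists_primitive_root hT, fun P k _ _ hk => bwtc_strPow P hk,
    ⟨16, bwtcProg, 300, fun a => ⟨a + 2, ?_⟩⟩⟩
  · rintro σ T ⟨hT, hA, hσ⟩
    obtain ⟨h1, h2⟩ := lt_two_pow_wordBits (List.length_pos_iff.2 hT) a
    exact bbwtProg_spec hT hA (hσ.trans h2) h1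
  · rw [← hj.bwtc_eq_bbwt, bwtc_rotate]
  · rintro σ T ⟨hT, hA, hσ⟩
    obtain ⟨h1, h2⟩ := lt_two_pow_wordBits (List.length_pos_iff.2 hT) a
    refine ⟨?_, ?_⟩
    · obtain ⟨P, k, hP0, hP, hk, rfl⟩ := exists_primitive_root hT
      obtain ⟨j, ⟨-, hj⟩, -⟩ := existsUnique_lyndon_rotate hP0 hP
      exact (bwtcProg_spec hk hj hA (hσ.trans h2) h1).2
    · rintro P k j - - hk rfl hj
      exact (bwtcProg_spec hk hj hA (hσ.trans h2) h1).1
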